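/- **Setting.** Let $n,L\ge 0$ be integers, $\Omega=[l,u]=\{x\in\mathbb R^n: l_j\le x_j\le u_j\ \forall j\}$ with $-l,u\in[0,\infty]^n$ and $l_j<u_j$ for all $j$, let $\lambda_1>0$, $\lambda_2\ge 0$, $p\in\{1,2\}$, $w_l\ge 0$, and let $G_1,\dots,G_L\subseteq\{1,\dots,n\}$ be (possibly overlapping) groups with $\bigcup_l G_l=\{1,\dots,n\}$; $x_{(l)}$ is the restriction of $x$ to $G_l$, and $\mathcal I(t)=1$ if $t\ne0$, $\mathcal I(0)=0$. Let $f:\mathbb R^n\to\mathbb R$ be convex, and consider $$\min_{x\in\Omega}\ F_0(x):=f(x)+\lambda_1\|x\|_0+\lambda_2\sum_{l=1}^L w_l\,\mathcal I(\|x_{(l)}\|_p).\tag{1}$$ Assume that $f$ is Lipschitz continuous and level-bounded on $\Omega$ (the sets $\{x\in\Omega: f(x)\le c\}$ are bounded), and that $f=f_n+f_s$ with $f_n,f_s:\mathbb R^n\to\mathbb R$ convex and $f_s$ differentiable with $L_s$-Lipschitz gradient on $\mathbb R^n$, $L_s>0$. Let $L_f$ be a real constant with $|\xi_j|\le L_f$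 for all $j$ and all $\xi\in\partial f(x)$, $x\in\Omega$, and also for all $\xi\in\partial f_n(x)+\partial f_s(y)$, $x,y\in\Omega$. Fix $\nu>0$ with $\nu L_f<\lambda_1$ and with $\nu<|l_i|$ whenever $l_i\neq0$, $\nu<u_j$ whenever $u_j\ne0$. For $\mu>0$ put $\theta_1(t;\mu)=0$, $\theta_2(t;\mu)=t/\mu-1$, $\theta_3(t;\mu)=-t/\mu-1$, and $R(x;\mu)=\frac{\lambda_1}{\mu}\|x\|_1+\frac{\lambda_2}{\mu}\sum_l w_l\|x_{(l)}\|_p$. For $I\in\{1,2,3\}^n$, $J\in\{1,2\}^L$ let $$\Theta_{I,J}(x;\mu)=\lambda_1\sum_j\theta_{I_j}(x_j;\mu)+\lambda_2\sum_l w_l\,\theta_{J_l}(\|x_{(l)}\|_p;\mu),$$ $$F(x;\mu)=f(x)+R(x;\mu)-\lambda_1\sum_j\max_{i\in\{1,2,3\}}\theta_i(x_j;\mu)-\lambda_2\sum_l w_l\max_{i\in\{1,2\}}\theta_i(\|x_{(l)}\|_p;\mu),$$ $$w_{I,J,\xi}(x;\mu,y,z)=f_n(x)+R(x;\mu)+f_s(y)+\langle\nabla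 f_s(y),x-y\rangle-\Theta_{I,J}(z;\mu)-\langle\xi,x-z\rangle .$$ Let $\mu_k=\bar\mu_k$ for $k<K$ and $\mu_k=\nu$ for $k\ge K$, where $K\in\mathbb N$ and $\{\bar\mu_k\}$ is a nonincreasing sequence with $\bar\mu_{K-1}\ge\nu\ge\bar\mu_K$ (the first inequality being void if $K=0$). Given a sequence $\{x^k\}$, let $I^k_j$ be the largest index maximizing $\theta_i(x^k_j;\kappa_k)$ over $i\in\{1,2,3\}$ and $J^k_l$ the largest index maximizing $\theta_i(\|x^k_{(l)}\|_p;\kappa_k)$ over $i\in\{1,2\}$, where either $\kappa_k=\nu$ for all $k$, or $\kappa_k=\mu_k$ for all $k$ (the two choices agree for $k\ge K$). **Algorithm 1.** Choose $x^0\in\Omega$, $\rho>1$, $c\in(0,L_s]$, $0<\underline\alpha\le\bar\alpha$ and an integer $N\ge0$. For $k=0,1,\dots$: choose $\alpha^B_k\in[\underline\alpha,\bar\alpha]$; for $m=0,1,\dots$ let $\alpha_k=\alpha_k^B\rho^m$, take some $\xi^k\in\partial_x\Theta_{I^k,J^k}(x^k;\mu_k)$, let $x^k(\alpha_k)$ be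 the minimizer over $x\in\Omega$ of $w_{I^k,J^k,\xi^k}(x;\mu_k,x^k,x^k)+\frac{\alpha_k}2\|x-x^k\|^2$, and stop at the first $m$ for which $$F(x^k(\alpha_k);\mu_k)\le\max_{\max\{k-N,0\}\le j\le k}F(x^j;\mu_k)-\frac c2\|x^k(\alpha_k)-x^k\|^2;$$ then set $x^{k+1}=x^k(\alpha_k)$. **Algorithm 2.** Choose $x^0\in\Omega$, $x^{-1}\in\mathbb R^n$ (for instance $x^{-1}=x^0$) and $\beta\in[0,1)$. For $k=0,1,\dots$: choose $\beta_k\in[0,\beta]$, set $y^k=x^k+\beta_k(x^k-x^{k-1})$, take some $\xi^k\in\partial_x\Theta_{I^k,J^k}(x^k;\mu_k)$, and let $x^{k+1}$ be the minimizer over $x\in\Omega$ of $w_{I^k,J^k,\xi^k}(x;\mu_k,y^k,x^k)+\frac{L_s}2\|x-y^k\|^2$. **Proposition.** Let $\{x^k\}_{k\ge0}$ be an infinite sequence of iterates generated by Algorithm 1 or by Algorithm 2. If $\{x^k\}$ has an isolated accumulation point, then the whole sequence $\{x^k\}$ converges to a $\nu$-strong local minimizer of (1), that is, to a local minimizer $x^*\in\Omega$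 of $F_0$ on $\Omega$ such that $|x^*_j|\ge\nu$ for every $j$ with $x^*_j\neq0$. -/

import Mathlib

open Set Filter Topology

noncomputable section

namespace SparseGroup

/-- `ℝⁿ` with the Euclidean norm and inner product. -/
abbrev E (n : ℕ) : Type := EuclideanSpace ℝ (Fin n)

/-- The subdifferential (in the sense of convex analysis) of a real-valued function on `ℝⁿ`. -/
def subdiff {n : ℕ} (h : E n → ℝ) (x : E n) : Set (E n) :=
  {ξ | ∀ y, h x + inner ℝ ξ (y - x) ≤ h y}

/-- `z` is a minimizer of `h` over the set `S`. -/
def IsArgmin {n : ℕ} (h : E n → ℝ) (S : Set (E n)) (z : E n) : Prop :=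
  z ∈ S ∧ IsMinOn h S z

/-- The function `𝓘(t) = 1` if `t ≠ 0`, and `𝓘(0) = 0`. -/
def ind (t : ℝ) : ℝ := if t = 0 then 0 else 1

/-- The three affine pieces `0`, `t / μ - 1`, `- t / μ - 1`; the indices `1, 2, 3` are
written `0, 1, 2 : Fin 3`. -/
def theta (i : Fin 3) (t μ : ℝ) : ℝ := ![0, t / μ - 1, -t / μ - 1] i

/-- `max {θ₁(t;μ), θ₂(t;μ), θ₃(t;μ)}`. -/
def maxTheta3 (t μ : ℝ) : ℝ :=
  Finset.univ.sup' Finset.univ_nonempty (fun i : Fin 3 => theta i t μ)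

/-- `max {θ₁(t;μ), θ₂(t;μ)}`. -/
def maxTheta2 (t μ : ℝ) : ℝ :=
  Finset.univ.sup' Finset.univ_nonempty (fun i : Fin 2 => theta i.castSucc t μ)

/-- The data of a sparse group problem on `ℝⁿ` with `L` groups: the loss `f` and its
splitting `f = fn + fs`, the (possibly infinite) bounds `lo, hi` of the box, the weights
`lam1, lam2, w`, the exponent `p`, the groups `G`, the relaxation parameter `nu` and the
constants `Lf`, `Ls`. What is required of the data is stated in `Assumptions`. -/
structure Problem (n L : ℕ) where
  f : E n → ℝ
  fn : E n → ℝ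
  fs : E n → ℝ
  lo : Fin n → EReal
  hi : Fin n → EReal
  lam1 : ℝ
  lam2 : ℝ
  p : ℕ
  w : Fin L → ℝ
  G : Fin L → Finset (Fin n)
  nu : ℝ
  Lf : ℝ
  Ls : ℝ

namespace Problem

variable {n L : ℕ} (P : Problem n L)

/-- The box `Ω = [lo, hi]`. -/
def Omega : Set (E n) := {x | ∀ j, P.lo j ≤ (x j : EReal) ∧ (x j : EReal) ≤ P.hi j}

/-- `‖x_(l)‖_p = (∑_{j ∈ G_l} |x_j|^p)^(1/p)`, the `ℓ_p` norm of the restriction of `x` to the group `G l`. -/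
def groupNorm (l : Fin L) (x : E n) : ℝ :=
  (∑ j ∈ P.G l, |x j| ^ P.p) ^ (1 / (P.p : ℝ))

/-- The objective function
`F₀(x) = f(x) + λ₁ ‖x‖₀ + λ₂ ∑ w_l 𝓘(‖x_(l)‖_p)` of the sparse group problem. -/
def F0 (x : E n) : ℝ :=
  P.f x + P.lam1 * ∑ j, ind (x j) + P.lam2 * ∑ l, P.w l * ind (P.groupNorm l x)

/-- `(λ₁/μ) ‖x‖₁ + (λ₂/μ) ∑ w_l ‖x_(l)‖_p`. -/
def penalty (x : E n) (μ : ℝ) : ℝ :=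
  P.lam1 / μ * ∑ j, |x j| + P.lam2 / μ * ∑ l, P.w l * P.groupNorm l x

/-- The relaxed objective `F(x;μ)`. -/
def F (x : E n) (μ : ℝ) : ℝ :=
  P.f x + P.penalty x μ - P.lam1 * ∑ j, maxTheta3 (x j) μ
    - P.lam2 * ∑ l, P.w l * maxTheta2 (P.groupNorm l x) μ

/-- `Θ_{I,J}(x;μ)`. -/
def Theta (I : Fin n → Fin 3) (J : Fin L → Fin 2) (x : E n) (μ : ℝ) : ℝ :=
  P.lam1 * ∑ j, theta (I j) (x j) μ
    + P.lam2 * ∑ l, P.w l * theta (J l).castSucc (P.groupNorm l x) μ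

/-- The convex model `w_{I,J,ξ}(x;μ,y,z)` of the relaxed objective. -/
def model (I : Fin n → Fin 3) (J : Fin L → Fin 2) (ξ : E n) (μ : ℝ) (y z x : E n) : ℝ :=
  (P.fn x + P.penalty x μ) + P.fs y + inner ℝ (gradient P.fs y) (x - y)
    - P.Theta I J z μ - inner ℝ ξ (x - z)

/-- `I = I^x` for the parameter `κ`: each `I_j` is the largest maximizing index of
`i ↦ θ_i(x_j;κ)` over the three indices. -/
def IsIdxI (κ : ℝ) (x : E n) (I : Fin n → Fin 3) : Prop :=
  ∀ j, IsGreatest {i : Fin 3 | ∀ i', theta i' (x j) κ ≤ theta i (x j) κ} (I j)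

/-- `J = J^x` for the parameter `κ`: each `J_l` is the largest maximizing index of
`i ↦ θ_i(‖x_(l)‖_p;κ)` over the first two indices. -/
def IsIdxJ (κ : ℝ) (x : E n) (J : Fin L → Fin 2) : Prop :=
  ∀ l, IsGreatest {i : Fin 2 | ∀ i' : Fin 2, theta i'.castSucc (P.groupNorm l x) κ
    ≤ theta i.castSucc (P.groupNorm l x) κ} (J l)

/-- `ϑ`, the smallest among the nonzero `|lo_i|` and the nonzero `hi_j` (`∞` if there are
none). -/
def vartheta : EReal :=
  sInf ({t | ∃ i, P.lo i ≠ 0 ∧ t = -P.lo i} ∪ {t | ∃ j, P.hi j ≠ 0 ∧ t = P.hi j})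

/-- The standing assumptions on the problem data. -/
structure Assumptions : Prop where
  lo_nonpos : ∀ j, P.lo j ≤ 0
  hi_nonneg : ∀ j, 0 ≤ P.hi j
  lo_lt_hi : ∀ j, P.lo j < P.hi j
  lam1_pos : 0 < P.lam1
  lam2_nonneg : 0 ≤ P.lam2
  p_eq : P.p = 1 ∨ P.p = 2
  w_nonneg : ∀ l, 0 ≤ P.w l
  cover : ∀ j, ∃ l, j ∈ P.G l
  f_convex : ConvexOn ℝ univ P.f
  f_lipschitz : ∃ C : NNReal, LipschitzOnWith C P.f P.Omega
  Lf_bound : ∀ x ∈ P.Omega, ∀ ξ ∈ subdiff P.f x, ∀ j, |ξ j| ≤ P.Lf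
  nu_pos : 0 < P.nu
  /-- `ν < λ₁ / L_f`, read as no restriction when `L_f = 0`. -/
  nu_lt : P.nu * P.Lf < P.lam1
  nu_lt_vartheta : (P.nu : EReal) < P.vartheta
  f_level_bounded : ∀ c : ℝ, Bornology.IsBounded {x | x ∈ P.Omega ∧ P.f x ≤ c}
  f_split : ∀ x, P.f x = P.fn x + P.fs x
  fn_convex : ConvexOn ℝ univ P.fn
  fs_convex : ConvexOn ℝ univ P.fs
  fs_differentiable : Differentiable ℝ P.fs
  Ls_pos : 0 < P.Ls
  fs_gradient_lipschitz : ∀ x y, ‖gradient P.fs x - gradient P.fs y‖ ≤ P.Ls * ‖x - y‖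
  Lf_bound_split : ∀ x ∈ P.Omega, ∀ y ∈ P.Omega, ∀ ξ ∈ subdiff P.fn x,
    ∀ ζ ∈ subdiff P.fs y, ∀ j, |(ξ + ζ) j| ≤ P.Lf

/-- `μ` is an admissible parameter sequence: it runs through the first `K` terms of a
decreasing sequence `μ̄` with `μ̄_{K-1} ≥ ν ≥ μ̄_K` and equals `ν` from then on (for `K = 0`
there is no `μ̄_{K-1}`). -/
def IsMuSeq (μ : ℕ → ℝ) : Prop :=
  ∃ (K : ℕ) (μbar : ℕ → ℝ), Antitone μbar ∧ (0 < K → P.nu ≤ μbar (K - 1)) ∧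
    μbar K ≤ P.nu ∧ ∀ k, μ k = if k < K then μbar k else P.nu

/-- The parameter `κ k` at which the index vectors `I^k`, `J^k` are computed: it is always
`ν`, or always the current `μ k`. -/
def IsIdxParam (μ κ : ℕ → ℝ) : Prop := (∀ k, κ k = P.nu) ∨ (∀ k, κ k = μ k)

/-- `x` is a sequence of iterates of the DC algorithm with line search. At step `k`, the
trial `t` of the inner loop uses the stepsize parameter `αB k * ρ ^ t`, a subgradient `ξ t`
and the solution `z t` of the subproblem; the loop stops at the first accepted trial, `m`. -/
def IsLineSearchRun (x : ℕ → E n) : Prop :=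
  ∃ (μ κ αB : ℕ → ℝ) (ρ c αlo αhi : ℝ) (N : ℕ),
    P.IsMuSeq μ ∧ P.IsIdxParam μ κ ∧ 1 < ρ ∧ 0 < c ∧ c ≤ P.Ls ∧ 0 < αlo ∧ αlo ≤ αhi ∧
    (∀ k, αlo ≤ αB k ∧ αB k ≤ αhi) ∧
    x 0 ∈ P.Omega ∧
    ∀ k, ∃ (I : Fin n → Fin 3) (J : Fin L → Fin 2) (m : ℕ) (ξ z : ℕ → E n),
      IsIdxI (κ k) (x k) I ∧ P.IsIdxJ (κ k) (x k) J ∧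
      (∀ t ≤ m, ξ t ∈ subdiff (fun v => P.Theta I J v (μ k)) (x k) ∧
        IsArgmin (fun v => P.model I J (ξ t) (μ k) (x k) (x k) v
          + αB k * ρ ^ t / 2 * ‖v - x k‖ ^ 2) P.Omega (z t)) ∧
      (∀ t < m, ¬ P.F (z t) (μ k) ≤
        (Finset.Icc (k - N) k).sup' (Finset.nonempty_Icc.2 (Nat.sub_le k N))
          (fun j => P.F (x j) (μ k)) - c / 2 * ‖z t - x k‖ ^ 2) ∧
      P.F (z m) (μ k) ≤
        (Finset.Icc (k - N) k).sup' (Finset.nonempty_Icc.2 (Nat.sub_le k N))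
          (fun j => P.F (x j) (μ k)) - c / 2 * ‖z m - x k‖ ^ 2 ∧
      x (k + 1) = z m

/-- `x` is a sequence of iterates of the DC algorithm with extrapolation. The point `xinit`
plays the role of `x^{-1}`; it is an arbitrary point (the choice `xinit = x 0` is usual). -/
def IsExtrapolationRun (x : ℕ → E n) : Prop :=
  ∃ (μ κ βs : ℕ → ℝ) (β : ℝ) (xinit : E n) (y : ℕ → E n),
    P.IsMuSeq μ ∧ P.IsIdxParam μ κ ∧ 0 ≤ β ∧ β < 1 ∧
    (∀ k, 0 ≤ βs k ∧ βs k ≤ β) ∧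
    x 0 ∈ P.Omega ∧
    y 0 = x 0 + βs 0 • (x 0 - xinit) ∧
    (∀ k, y (k + 1) = x (k + 1) + βs (k + 1) • (x (k + 1) - x k)) ∧
    ∀ k, ∃ (I : Fin n → Fin 3) (J : Fin L → Fin 2) (ξ : E n),
      IsIdxI (κ k) (x k) I ∧ P.IsIdxJ (κ k) (x k) J ∧
      ξ ∈ subdiff (fun v => P.Theta I J v (μ k)) (x k) ∧
      IsArgmin (fun v => P.model I J ξ (μ k) (y k) (x k) v
        + P.Ls / 2 * ‖v - y k‖ ^ 2) P.Omega (x (k + 1))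

/-- `x` is a `ν`-strong local minimizer of the problem `min {F₀(x) : x ∈ Ω}`: a local
minimizer whose nonzero entries are at least `ν` in absolute value. -/
def IsStrongLocalMin (x : E n) : Prop :=
  x ∈ P.Omega ∧ IsLocalMinOn P.F0 P.Omega x ∧ ∀ j, x j ≠ 0 → P.nu ≤ |x j|

end Problem

/-- The set of accumulation points of a sequence. -/
def accPts {n : ℕ} (x : ℕ → E n) : Set (E n) := {a | MapClusterPt a atTop x}

/-- `a` is an isolated accumulation point of the sequence `x`: an accumulation point with a
neighbourhood that contains no other one. -/
def IsIsolatedAccPt {n : ℕ} (x : ℕ → E n) (a : E n) : Prop :=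
  a ∈ accPts x ∧ ∃ δ > 0, ∀ b ∈ accPts x, b ∈ Metric.ball a δ → b = a

end SparseGroup

end

/-! The relaxed objective is a difference of convex functions: a penalty minus a maximum of finitely
many simple pieces. Freezing the pieces and linearizing them gives a convex majorant that touches
`F` at the current iterate (`F_le_model`, `model_self_le`). Once both parameters equal `ν`, this
yields sufficient decrease, nonmonotone for the line search and in terms of `F` plus a squared step
length for the extrapolation. Since sublevel sets are bounded, successive distances tend to zero,
and Ostrowski's lemma turns an isolated accumulation point into a limit `a`.

There are finitely many index pairs, so one pair `(I, J)` recurs forever; passing to the limit along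
it gives `IsLiftedStationary`. In directions supported in the support of `a` the pieces are
differentiable, so the linearization by `ξ` is exact to first order and `f` can be compared directly
at `a` and at `a + d` (`le_add_of_direction`).

Two choices of `d` finish the analysis. Erasing a nonzero coordinate with `I j = 0` saves penalty at
rate `λ₁/ν`, while `f` rises at rate at most `L_f`; as `ν L_f < λ₁`, such coordinates vanish and all
others have modulus at least `ν`. Thereafter penalty minus pieces is locally constant on the
support, so `a` minimizes `f` over points of the box supported there. This gives local minimality
for `F₀`: near `a` the support can only grow, and each new nonzero entry costs `λ₁`, more than the
continuous `f` can gain. -/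

namespace SparseGroup

/-! ### Subgradients, the descent lemma and proximal steps. -/

section ConvexAnalysis

variable {n : ℕ}

lemma continuous_of_convexOn {h : E n → ℝ} (hh : ConvexOn ℝ univ h) : Continuous h :=
  continuousOn_univ.1 (hh.continuousOn isOpen_univ)

/-- A finite convex function on `ℝⁿ` has a subgradient at each point. -/
lemma subdiff_nonempty {h : E n → ℝ} (hh : ConvexOn ℝ univ h) (x : E n) :
    (subdiff h x).Nonempty := by
  have hc := continuous_of_convexOn hh
  have hA : Convex ℝ {p : E n × ℝ | p.1 ∈ univ ∧ h p.1 < p.2} := hh.convex_strict_epigraph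
  have hO : IsOpen {p : E n × ℝ | p.1 ∈ univ ∧ h p.1 < p.2} := by
    simp only [mem_univ, true_and]
    exact isOpen_lt (hc.comp continuous_fst) continuous_snd
  obtain ⟨T, hT⟩ := geometric_hahn_banach_open_point hA hO
    (x := ((x, h x) : E n × ℝ)) (by simp)
  set l : E n →L[ℝ] ℝ := T.comp (ContinuousLinearMap.inl ℝ (E n) ℝ) with hl
  set c : ℝ := T (0, 1) with hcdef
  have hTe : ∀ v t, T (v, t) = l v + t * c := by
    intro v t
    have : ((v, t) : E n × ℝ) = (v, 0) + t • (0, 1) := by simp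
    rw [this, map_add, map_smul]
    simp [hl, hcdef]
  have hlt : ∀ v t, h v < t → l v + t * c < l x + h x * c := by
    intro v t ht
    have := hT (v, t) (by simpa using ht)
    rwa [hTe, hTe] at this
  -- Testing directly above `(x, h x)` shows that the separating hyperplane is not vertical, so
  -- dividing by `-c` yields a subgradient.
  have hcneg : c < 0 := by
    have := hlt x (h x + 1) (by linarith)
    linarith
  have hle : ∀ v, l v + h v * c ≤ l x + h x * c := by
    intro v
    refine le_of_forall_pos_lt_add fun ε hε => ?_
    have := hlt v (h v + ε / (-c)) (by have := div_pos hε (neg_pos.2 hcneg); linarith)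
    have h2 : (h v + ε / (-c)) * c = h v * c - ε := by
      have := hcneg.ne
      field_simp
      ring
    linarith
  refine ⟨(InnerProductSpace.toDual ℝ (E n)).symm ((-c)⁻¹ • l), fun y => ?_⟩
  rw [InnerProductSpace.toDual_symm_apply]
  have := hle y
  simp only [smul_apply, map_sub, smul_eq_mul]
  have hcp : 0 < -c := neg_pos.2 hcneg
  have h3 : (-c)⁻¹ * (l y - l x) ≤ h y - h x := by
    rw [inv_mul_le_iff₀ hcp]
    linarith
  linarith

lemma hasDerivAt_line {h : E n → ℝ} (hd : Differentiable ℝ h) (y d : E n) (t : ℝ) :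
    HasDerivAt (fun s : ℝ => h (y + s • d)) (inner ℝ (gradient h (y + t • d)) d) t := by
  have h1 : HasDerivAt (fun s : ℝ => y + s • d) d t := by
    simpa using ((hasDerivAt_id t).smul_const d).const_add y
  have h2 := (hd (y + t • d)).hasGradientAt.hasFDerivAt.comp_hasDerivAt t h1
  exact h2.congr_deriv (by rw [InnerProductSpace.toDual_apply_apply])

/-- The slope inequality along a segment. -/
lemma segment_le {h : E n → ℝ} (hh : ConvexOn ℝ univ h) (a d : E n) {t : ℝ} (h0 : 0 ≤ t)
    (h1 : t ≤ 1) : h (a + t • d) - h a ≤ t * (h (a + d) - h a) := by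
  have := hh.2 (mem_univ a) (mem_univ (a + d)) (sub_nonneg.2 h1) h0 (by ring)
  have e : (1 - t) • a + t • (a + d) = a + t • d := by
    rw [sub_smul, smul_add, one_smul]; abel
  rw [e] at this
  simp only [smul_eq_mul] at this
  linarith

lemma inner_gradient_le {h : E n → ℝ} (hh : ConvexOn ℝ univ h) (hd : Differentiable ℝ h)
    (y x : E n) : h y + inner ℝ (gradient h y) (x - y) ≤ h x := by
  have h1 := hasDerivAt_line hd y (x - y) 0
  simp only [zero_smul, add_zero] at h1
  have h2 := (h1.tendsto_slope_zero_right)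
  have h3 : ∀ᶠ t : ℝ in 𝓝[>] 0, t⁻¹ • (h (y + (0 + t) • (x - y)) - h (y + (0:ℝ) • (x - y)))
      ≤ h x - h y := by
    have : Ioo (0:ℝ) 1 ∈ 𝓝[>] (0:ℝ) := Ioo_mem_nhdsGT one_pos
    filter_upwards [this] with t ht
    have := segment_le hh y (x - y) ht.1.le ht.2.le
    simp only [zero_add, zero_smul, add_zero, smul_eq_mul, add_sub_cancel] at this ⊢
    rw [inv_mul_le_iff₀ ht.1]
    exact this
  have := le_of_tendsto h2 (by simpa using h3)
  linarith

/-- The descent lemma for functions with a Lipschitz gradient. -/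
lemma le_quadratic_of_gradient_lipschitz {h : E n → ℝ} (hd : Differentiable ℝ h) {C : ℝ}
    (hC : ∀ x y, ‖gradient h x - gradient h y‖ ≤ C * ‖x - y‖) (y x : E n) :
    h x ≤ h y + inner ℝ (gradient h y) (x - y) + C / 2 * ‖x - y‖ ^ 2 := by
  set d := x - y with hdd
  -- The error of the quadratic upper model along the segment; its derivative is nonpositive on `(0,
  -- 1)`, and the claim compares the endpoints.
  set φ : ℝ → ℝ := fun t => h (y + t • d) - t * inner ℝ (gradient h y) d
    - t ^ 2 * (C / 2 * ‖d‖ ^ 2) with hφ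
  have hder : ∀ t, HasDerivAt φ (inner ℝ (gradient h (y + t • d)) d - inner ℝ (gradient h y) d
      - 2 * t * (C / 2 * ‖d‖ ^ 2)) t := by
    intro t
    have h1 := hasDerivAt_line hd y d t
    have h2 := (hasDerivAt_id t).mul_const (inner ℝ (gradient h y) d)
    have h3 := ((hasDerivAt_id t).pow 2).mul_const (C / 2 * ‖d‖ ^ 2)
    exact ((h1.sub h2).sub h3).congr_deriv (by simp)
  have hanti : AntitoneOn φ (Icc 0 1) := by
    refine antitoneOn_of_deriv_nonpos (convex_Icc 0 1)
      (fun t _ => (hder t).continuousAt.continuousWithinAt)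
      (fun t _ => (hder t).differentiableAt.differentiableWithinAt) fun t ht => ?_
    rw [interior_Icc] at ht
    rw [(hder t).deriv, ← inner_sub_left]
    have h1 := real_inner_le_norm (gradient h (y + t • d) - gradient h y) d
    have h2 := hC (y + t • d) y
    rw [add_sub_cancel_left, norm_smul, Real.norm_of_nonneg ht.1.le] at h2
    have h3 := mul_le_mul_of_nonneg_right h2 (norm_nonneg d)
    nlinarith
  have := hanti (left_mem_Icc.2 zero_le_one) (right_mem_Icc.2 zero_le_one) zero_le_one
  simp only [hφ, one_smul, zero_smul, hdd, add_sub_cancel] at this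
  simp only [add_zero] at this
  linarith

/-- A proximal step on a convex function satisfies the three-point inequality. -/
lemma prox_three_point {h : E n → ℝ} {S : Set (E n)} (hh : ConvexOn ℝ univ h)
    (hS : Convex ℝ S) {a : ℝ} {y z : E n}
    (hz : IsArgmin (fun v => h v + a / 2 * ‖v - y‖ ^ 2) S z) {x : E n} (hx : x ∈ S) :
    h z + a / 2 * ‖z - y‖ ^ 2 + a / 2 * ‖x - z‖ ^ 2 ≤ h x + a / 2 * ‖x - y‖ ^ 2 := by
  -- Minimality of `z` against `z + t (x - z)`, divided by `t`; letting `t` tend to zero gives the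
  -- first-order condition.
  have key : ∀ t ∈ Ioo (0:ℝ) 1, 0 ≤ h x - h z + a * inner ℝ (z - y) (x - z)
      + t * (a / 2 * ‖x - z‖ ^ 2) := by
    intro t ht
    have hmem : z + t • (x - z) ∈ S := hS.add_smul_sub_mem hz.1 hx ⟨ht.1.le, ht.2.le⟩
    have h1 := isMinOn_iff.1 hz.2 _ hmem
    have h2 := segment_le hh z (x - z) ht.1.le ht.2.le
    rw [add_sub_cancel] at h2
    have h3 : ‖z + t • (x - z) - y‖ ^ 2 = ‖z - y‖ ^ 2 + 2 * (t * inner ℝ (z - y) (x - z))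
        + t ^ 2 * ‖x - z‖ ^ 2 := by
      rw [show z + t • (x - z) - y = (z - y) + t • (x - z) by abel, norm_add_sq_real,
        inner_smul_right, norm_smul, mul_pow, Real.norm_eq_abs, sq_abs]
    simp only [h3] at h1
    refine nonneg_of_mul_nonneg_right (a := t) ?_ ht.1
    nlinarith
  have hlim : Tendsto (fun t : ℝ => h x - h z + a * inner ℝ (z - y) (x - z)
      + t * (a / 2 * ‖x - z‖ ^ 2)) (𝓝[>] 0) (𝓝 (h x - h z + a * inner ℝ (z - y) (x - z)
      + 0 * (a / 2 * ‖x - z‖ ^ 2))) :=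
    tendsto_nhdsWithin_of_tendsto_nhds (Continuous.tendsto (by fun_prop) _)
  have h0 := ge_of_tendsto hlim (by
    filter_upwards [Ioo_mem_nhdsGT (one_pos : (0:ℝ) < 1)] with t ht using key t ht)
  have h4 : ‖x - y‖ ^ 2 = ‖z - y‖ ^ 2 + 2 * inner ℝ (z - y) (x - z) + ‖x - z‖ ^ 2 := by
    rw [← norm_add_sq_real]; congr 2; abel
  rw [h4]
  nlinarith

end ConvexAnalysis

end SparseGroup

namespace SparseGroup

/-! ### The affine pieces and their maxima. -/

lemma theta_zero (t μ : ℝ) : theta 0 t μ = 0 := rfl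
lemma theta_one (t μ : ℝ) : theta 1 t μ = t / μ - 1 := rfl
lemma theta_two (t μ : ℝ) : theta 2 t μ = -t / μ - 1 := rfl

lemma theta_le_abs (i : Fin 3) (t : ℝ) {μ : ℝ} (hμ : 0 < μ) : theta i t μ ≤ |t| / μ := by
  have h0 : 0 ≤ |t| / μ := by positivity
  have h1 : t / μ ≤ |t| / μ := by gcongr; exact le_abs_self t
  have h2 : -t / μ ≤ |t| / μ := by gcongr; exact neg_le_abs t
  fin_cases i
  · exact h0
  · change t / μ - 1 ≤ _; linarith
  · change -t / μ - 1 ≤ _; linarith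

lemma continuous_theta (i : Fin 3) (μ : ℝ) : Continuous fun t => theta i t μ := by
  fin_cases i
  · exact continuous_const
  · exact (continuous_id.div_const μ).sub continuous_const
  · exact (continuous_neg.div_const μ).sub continuous_const

lemma differentiable_theta (i : Fin 3) (μ : ℝ) : Differentiable ℝ fun t => theta i t μ := by
  fin_cases i
  · exact differentiable_const _
  · exact (differentiable_id.div_const μ).sub_const 1
  · exact (differentiable_id.neg.div_const μ).sub_const 1

lemma continuous_maxTheta3 (μ : ℝ) : Continuous fun t => maxTheta3 t μ :=
  Continuous.finset_sup'_apply _ fun i _ => continuous_theta i μ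

lemma continuous_maxTheta2 (μ : ℝ) : Continuous fun t => maxTheta2 t μ :=
  Continuous.finset_sup'_apply _ fun i _ => continuous_theta i.castSucc μ

lemma theta_le_maxTheta3 (i : Fin 3) (t μ : ℝ) : theta i t μ ≤ maxTheta3 t μ :=
  Finset.le_sup' (fun i : Fin 3 => theta i t μ) (Finset.mem_univ i)

lemma theta_le_maxTheta2 (i : Fin 2) (t μ : ℝ) : theta i.castSucc t μ ≤ maxTheta2 t μ :=
  Finset.le_sup' (fun i : Fin 2 => theta i.castSucc t μ) (Finset.mem_univ i)

lemma maxTheta3_le_abs (t : ℝ) {μ : ℝ} (hμ : 0 < μ) : maxTheta3 t μ ≤ |t| / μ :=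
  Finset.sup'_le _ _ fun i _ => theta_le_abs i t hμ

lemma maxTheta2_le_abs (t : ℝ) {μ : ℝ} (hμ : 0 < μ) : maxTheta2 t μ ≤ |t| / μ :=
  Finset.sup'_le _ _ fun i _ => theta_le_abs i.castSucc t hμ

namespace Problem

variable {n L : ℕ} (P : Problem n L)

/-! ### Consequences of the index selection rule. -/

section Index

variable {P}

lemma le_of_isIdxI_one {ν : ℝ} (hν : 0 < ν) {x : E n} {I : Fin n → Fin 3} (h : IsIdxI ν x I)
    {j : Fin n} (hj : I j = 1) : ν ≤ x j := by
  have := (h j).1 0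
  rw [hj, theta_zero, theta_one, sub_nonneg, one_le_div hν] at this
  exact this

lemma le_of_isIdxI_two {ν : ℝ} (hν : 0 < ν) {x : E n} {I : Fin n → Fin 3} (h : IsIdxI ν x I)
    {j : Fin n} (hj : I j = 2) : x j ≤ -ν := by
  have := (h j).1 0
  rw [hj, theta_zero, theta_two, sub_nonneg, one_le_div hν] at this
  linarith

lemma le_abs_of_isIdxI {ν : ℝ} (hν : 0 < ν) {x : E n} {I : Fin n → Fin 3} (h : IsIdxI ν x I)
    {j : Fin n} (hj : I j ≠ 0) : ν ≤ |x j| := by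
  have : I j = 1 ∨ I j = 2 := by omega
  rcases this with h1 | h2
  · exact (le_of_isIdxI_one hν h h1).trans (le_abs_self _)
  · have := le_of_isIdxI_two hν h h2
    exact le_trans (by linarith) (neg_le_abs _)

/-- Ties go to the larger index, hence the strict inequality; it is what makes `J l = 0`
incompatible with an entry of modulus at least `ν` in the group. -/
lemma groupNorm_lt_of_isIdxJ {ν : ℝ} (hν : 0 < ν) {x : E n} {J : Fin L → Fin 2}
    (h : P.IsIdxJ ν x J) {l : Fin L} (hl : J l = 0) : P.groupNorm l x < ν := by
  by_contra! hge
  have h1 : (1 : Fin 2) ≤ J l := by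
    refine (h l).2 fun i' => ?_
    have h2 : 0 ≤ P.groupNorm l x / ν - 1 := by
      rw [sub_nonneg, one_le_div hν]; exact hge
    have : i' = 0 ∨ i' = 1 := by omega
    rcases this with rfl | rfl
    · exact h2
    · exact le_rfl
  rw [hl] at h1
  exact absurd h1 (by decide)

lemma maxTheta3_eq_of_isIdxI {ν : ℝ} {x : E n} {I : Fin n → Fin 3} (h : IsIdxI ν x I)
    (j : Fin n) : maxTheta3 (x j) ν = theta (I j) (x j) ν :=
  le_antisymm (Finset.sup'_le _ _ fun i _ => (h j).1 i) (theta_le_maxTheta3 _ _ _)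

lemma maxTheta2_eq_of_isIdxJ {ν : ℝ} {x : E n} {J : Fin L → Fin 2} (h : P.IsIdxJ ν x J)
    (l : Fin L) : maxTheta2 (P.groupNorm l x) ν = theta (J l).castSucc (P.groupNorm l x) ν :=
  le_antisymm (Finset.sup'_le _ _ fun i _ => (h l).1 i) (theta_le_maxTheta2 _ _ _)

end Index

/-! ### Group norms: monotonicity, convexity, differentiability along the support. -/

section GroupNorm

lemma groupNorm_nonneg (l : Fin L) (x : E n) : 0 ≤ P.groupNorm l x := by
  unfold groupNorm; positivity

lemma groupNorm_mono {l : Fin L} {x y : E n} (h : ∀ j ∈ P.G l, |x j| ≤ |y j|) :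
    P.groupNorm l x ≤ P.groupNorm l y := by
  unfold groupNorm
  exact Real.rpow_le_rpow (by positivity) (Finset.sum_le_sum fun j hj =>
    pow_le_pow_left₀ (abs_nonneg _) (h j hj) _) (by positivity)

lemma continuous_groupNorm (l : Fin L) : Continuous (P.groupNorm l) := by
  unfold groupNorm
  refine Continuous.rpow_const ?_ fun x => Or.inr (by positivity)
  fun_prop

variable {P}

lemma abs_le_groupNorm (hP : P.Assumptions) {l : Fin L} {j : Fin n} (hj : j ∈ P.G l) (x : E n) :
    |x j| ≤ P.groupNorm l x := by
  have hp : P.p ≠ 0 := by rcases hP.p_eq with h | h <;> omega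
  unfold groupNorm
  calc |x j| = (|x j| ^ P.p) ^ (1 / (P.p : ℝ)) := by
        rw [one_div, Real.pow_rpow_inv_natCast (abs_nonneg _) hp]
    _ ≤ _ := by
        gcongr
        exact Finset.single_le_sum (f := fun j => |x j| ^ P.p) (fun i _ => by positivity) hj

lemma groupNorm_eq_zero (hP : P.Assumptions) {l : Fin L} {x : E n} :
    P.groupNorm l x = 0 ↔ ∀ j ∈ P.G l, x j = 0 := by
  refine ⟨fun h j hj => ?_, fun h => ?_⟩
  · have := abs_le_groupNorm hP hj x
    rw [h] at this
    exact abs_nonpos_iff.1 this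
  · refine le_antisymm ?_ (P.groupNorm_nonneg l x)
    have hp : P.p ≠ 0 := by rcases hP.p_eq with h | h <;> omega
    unfold groupNorm
    rw [Finset.sum_eq_zero fun j hj => by rw [h j hj, abs_zero, zero_pow hp],
      Real.zero_rpow (by positivity)]

lemma groupNorm_add_le (hP : P.Assumptions) (l : Fin L) (x y : E n) :
    P.groupNorm l (x + y) ≤ P.groupNorm l x + P.groupNorm l y := by
  have hp : (1 : ℝ) ≤ P.p := by
    rcases hP.p_eq with h | h <;> rw [h] <;> norm_num
  have := Real.Lp_add_le (P.G l) (fun j => x j) (fun j => y j) hp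
  simp only [Real.rpow_natCast] at this
  exact this

lemma groupNorm_smul (hP : P.Assumptions) (l : Fin L) {t : ℝ} (ht : 0 ≤ t) (x : E n) :
    P.groupNorm l (t • x) = t * P.groupNorm l x := by
  have hp : P.p ≠ 0 := by rcases hP.p_eq with h | h <;> omega
  unfold groupNorm
  simp only [PiLp.smul_apply, smul_eq_mul, abs_mul, mul_pow, ← Finset.mul_sum]
  rw [Real.mul_rpow (by positivity) (by positivity), abs_of_nonneg ht, one_div,
    Real.pow_rpow_inv_natCast ht hp]

lemma convexOn_groupNorm (hP : P.Assumptions) (l : Fin L) :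
    ConvexOn ℝ univ (P.groupNorm l) := by
  refine ⟨convex_univ, fun x _ y _ a b ha hb _ => ?_⟩
  refine (groupNorm_add_le hP l _ _).trans ?_
  rw [groupNorm_smul hP l ha, groupNorm_smul hP l hb]
  rfl

lemma differentiableAt_abs_line {a d : ℝ} (h : a = 0 → d = 0) :
    DifferentiableAt ℝ (fun t : ℝ => |a + t * d|) 0 := by
  by_cases ha : a = 0
  · simp [ha, h ha]
  · refine DifferentiableAt.abs (by fun_prop) (by simpa using ha)

/-- The group norms are differentiable at `a` in the directions supported in the support
of `a`. -/
lemma differentiableAt_groupNorm_line (hP : P.Assumptions) (l : Fin L) {a d : E n}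
    (h : ∀ j, a j = 0 → d j = 0) :
    DifferentiableAt ℝ (fun t : ℝ => P.groupNorm l (a + t • d)) 0 := by
  have hsum : DifferentiableAt ℝ (fun t : ℝ => ∑ j ∈ P.G l, |(a + t • d) j| ^ P.p) 0 := by
    refine DifferentiableAt.fun_sum fun j _ => ?_
    exact (differentiableAt_abs_line (h j)).pow _
  unfold groupNorm
  rcases hP.p_eq with hp | _
  · rw [hp] at hsum ⊢
    simpa using hsum
  by_cases h0 : ∀ j ∈ P.G l, a j = 0
  · have hp : P.p ≠ 0 := by rcases hP.p_eq with h | h <;> omega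
    have : ∀ t : ℝ, ∑ j ∈ P.G l, |(a + t • d) j| ^ P.p = 0 := fun t =>
      Finset.sum_eq_zero fun j hj => by simp [h0 j hj, h j (h0 j hj), hp]
    simp only [this]
    exact differentiableAt_const _
  · push Not at h0
    obtain ⟨j, hj, hne⟩ := h0
    -- The root is smooth here because some entry of the group is nonzero, so its argument is
    -- positive at `t = 0`.
    refine hsum.rpow_const (Or.inl ?_)
    have : 0 < ∑ j ∈ P.G l, |(a + (0:ℝ) • d) j| ^ P.p :=
      Finset.sum_pos' (fun i _ => by positivity) ⟨j, hj, by simp; positivity⟩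
    exact this.ne'

end GroupNorm

/-! ### The relaxed objective and the box. -/

section Objective

lemma penalty_eq (x : E n) (μ : ℝ) : P.penalty x μ =
    P.lam1 * ∑ j, |x j| / μ + P.lam2 * ∑ l, P.w l * (P.groupNorm l x / μ) := by
  unfold penalty
  simp only [Finset.mul_sum]
  congr 1 <;> exact Finset.sum_congr rfl fun _ _ => by ring

/-- The concave part left over when the linear pieces selected by `I, J` are subtracted from
the penalty. -/
lemma penalty_sub_Theta (I : Fin n → Fin 3) (J : Fin L → Fin 2) (x : E n) (μ : ℝ) :
    P.penalty x μ - P.Theta I J x μ = P.lam1 * ∑ j, (|x j| / μ - theta (I j) (x j) μ)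
      + P.lam2 * ∑ l, P.w l * (P.groupNorm l x / μ
        - theta (J l).castSucc (P.groupNorm l x) μ) := by
  rw [penalty_eq]
  unfold Theta
  simp only [mul_sub, Finset.sum_sub_distrib]
  ring

lemma F_eq (x : E n) (μ : ℝ) : P.F x μ = P.f x + (P.lam1 * ∑ j, (|x j| / μ - maxTheta3 (x j) μ)
      + P.lam2 * ∑ l, P.w l * (P.groupNorm l x / μ - maxTheta2 (P.groupNorm l x) μ)) := by
  unfold F
  rw [penalty_eq]
  simp only [mul_sub, Finset.sum_sub_distrib]
  ring

lemma continuous_penalty (μ : ℝ) : Continuous fun x => P.penalty x μ := by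
  unfold penalty
  have := P.continuous_groupNorm
  fun_prop

lemma continuous_Theta (I : Fin n → Fin 3) (J : Fin L → Fin 2) (μ : ℝ) :
    Continuous fun x => P.Theta I J x μ := by
  unfold Theta
  refine (continuous_const.mul (continuous_finsetSum _ fun j _ => ?_)).add
    (continuous_const.mul (continuous_finsetSum _ fun l _ => continuous_const.mul ?_))
  · exact (continuous_theta (I j) μ).comp (by fun_prop)
  · exact (continuous_theta (J l).castSucc μ).comp (P.continuous_groupNorm l)

variable {P}

lemma continuous_F (hP : P.Assumptions) (μ : ℝ) : Continuous fun x => P.F x μ := by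
  unfold F
  refine (((continuous_of_convexOn hP.f_convex).add (P.continuous_penalty μ)).sub
    (continuous_const.mul (continuous_finsetSum _ fun j _ => ?_))).sub
    (continuous_const.mul (continuous_finsetSum _ fun l _ => continuous_const.mul ?_))
  · exact (continuous_maxTheta3 μ).comp (by fun_prop)
  · exact (continuous_maxTheta2 μ).comp (P.continuous_groupNorm l)

lemma convexOn_penalty (hP : P.Assumptions) {μ : ℝ} (hμ : 0 < μ) :
    ConvexOn ℝ univ fun x => P.penalty x μ := by
  have h1 : ∀ j : Fin n, ConvexOn ℝ univ fun x : E n => |x j| := fun j => by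
    have := (convexOn_norm (E := ℝ) convex_univ).comp_linearMap
      (EuclideanSpace.proj j : E n →L[ℝ] ℝ).toLinearMap
    simpa [Function.comp_def] using this
  have hs : ∀ {ι : Type} (s : Finset ι) (g : ι → E n → ℝ), (∀ i, ConvexOn ℝ univ (g i)) →
      ConvexOn ℝ univ fun x => ∑ i ∈ s, g i x := by
    intro ι s g hg
    classical
    induction s using Finset.induction_on with
    | empty => simpa using convexOn_const (0:ℝ) convex_univ
    | insert i s hi ih =>
      simp only [Finset.sum_insert hi]
      exact (hg i).add ih
  have a1 := (hs Finset.univ _ h1).smul (div_nonneg hP.lam1_pos.le hμ.le)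
  have a2 := (hs Finset.univ _ fun l => (convexOn_groupNorm hP l).smul (hP.w_nonneg l)).smul
    (div_nonneg hP.lam2_nonneg hμ.le)
  exact a1.add a2

/-- Any selected piece lies below the maximum that is subtracted, and all weights are nonnegative.
Equality holds for maximizing indices (`F_eq_of_isIdx`), so the majorant touches `F` there. -/
lemma F_le (hP : P.Assumptions) (I : Fin n → Fin 3) (J : Fin L → Fin 2) (x : E n) (μ : ℝ) :
    P.F x μ ≤ P.f x + (P.penalty x μ - P.Theta I J x μ) := by
  rw [F_eq, penalty_sub_Theta]
  have h1 := hP.lam1_pos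
  have h2 := hP.lam2_nonneg
  have h3 := hP.w_nonneg
  gcongr with j _ l _
  · exact theta_le_maxTheta3 _ _ _
  · exact h3 l
  · exact theta_le_maxTheta2 _ _ _

lemma F_eq_of_isIdx {I : Fin n → Fin 3} {J : Fin L → Fin 2} {x : E n} {μ : ℝ}
    (hI : IsIdxI μ x I) (hJ : P.IsIdxJ μ x J) :
    P.F x μ = P.f x + (P.penalty x μ - P.Theta I J x μ) := by
  rw [F_eq, penalty_sub_Theta]
  simp only [maxTheta3_eq_of_isIdxI hI, maxTheta2_eq_of_isIdxJ hJ]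

/-- The capped penalty is nonnegative; this transfers level-boundedness from `f` to `F`. -/
lemma f_le_F (hP : P.Assumptions) (x : E n) {μ : ℝ} (hμ : 0 < μ) : P.f x ≤ P.F x μ := by
  rw [F_eq]
  have h1 := hP.lam1_pos
  have h2 := hP.lam2_nonneg
  have a1 : 0 ≤ ∑ j, (|x j| / μ - maxTheta3 (x j) μ) :=
    Finset.sum_nonneg fun j _ => sub_nonneg.2 (maxTheta3_le_abs _ hμ)
  have a2 : 0 ≤ ∑ l, P.w l * (P.groupNorm l x / μ - maxTheta2 (P.groupNorm l x) μ) :=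
    Finset.sum_nonneg fun l _ => mul_nonneg (hP.w_nonneg l) (sub_nonneg.2 (by
      simpa [abs_of_nonneg (P.groupNorm_nonneg l x)] using
        maxTheta2_le_abs (P.groupNorm l x) hμ))
  have := mul_nonneg h1.le a1
  have := mul_nonneg h2 a2
  linarith

variable (P) in
lemma isClosed_Omega : IsClosed P.Omega := by
  have : P.Omega = ⋂ j, {x : E n | P.lo j ≤ (x j : EReal) ∧ (x j : EReal) ≤ P.hi j} := by
    ext x; simp [Omega]
  rw [this]
  refine isClosed_iInter fun j => ?_
  have hc : Continuous fun x : E n => ((x j : ℝ) : EReal) :=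
    continuous_coe_real_ereal.comp (by fun_prop)
  exact (isClosed_le continuous_const hc).inter (isClosed_le hc continuous_const)

variable (P) in
lemma convex_Omega : Convex ℝ P.Omega := by
  intro x hx y hy a b ha hb hab j
  -- The bounds may be infinite, so convexity of each side is obtained from order-connectedness.
  have hc : OrdConnected ((fun r : ℝ => (r : EReal)) ⁻¹' Icc (P.lo j) (P.hi j)) :=
    ordConnected_Icc.preimage_mono fun _ _ h => EReal.coe_le_coe_iff.2 h
  exact hc.convex (𝕜 := ℝ) (hx j) (hy j) ha hb hab

/-- Setting a coordinate to zero does not leave the box. -/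
lemma add_neg_single_mem_Omega (hP : P.Assumptions) {a : E n} (ha : a ∈ P.Omega) (j : Fin n) :
    a + EuclideanSpace.single j (-a j) ∈ P.Omega := by
  intro i
  by_cases hij : i = j
  · subst hij
    simpa using ⟨hP.lo_nonpos i, hP.hi_nonneg i⟩
  · simpa [hij] using ha i

/-- Sublevel sets of the objective meet the box in subsets of a compact subset of the box. -/
lemma exists_isCompact_sublevel (hP : P.Assumptions) (c : ℝ) :
    ∃ S : Set (E n), IsCompact S ∧ ∀ x ∈ P.Omega, P.F x P.nu ≤ c → x ∈ S := by
  refine ⟨_, (hP.f_level_bounded c).isCompact_closure, fun x hx h => subset_closure ⟨hx, ?_⟩⟩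
  exact (f_le_F hP x hP.nu_pos).trans h

end Objective

end Problem

end SparseGroup

namespace SparseGroup

/-! ### Sequences with vanishing steps. -/

section Sequences

variable {n : ℕ}

/-- Ostrowski's lemma: if successive distances tend to zero, a sequence with an isolated
accumulation point converges to it. -/
lemma tendsto_of_isIsolatedAccPt {x : ℕ → E n} {a : E n} (ha : IsIsolatedAccPt x a)
    (hx : Tendsto (fun k => ‖x (k + 1) - x k‖) atTop (𝓝 0)) : Tendsto x atTop (𝓝 a) := by
  obtain ⟨hacc, δ, hδ, hiso⟩ := ha
  by_contra hcon
  rw [Metric.tendsto_nhds] at hcon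
  push Not at hcon
  obtain ⟨ε, hε, hfar⟩ := hcon
  obtain ⟨r, hr, hrε, hrδ⟩ : ∃ r > 0, r ≤ ε ∧ r < δ :=
    ⟨min ε (δ / 2), by positivity, min_le_left _ _, (min_le_right _ _).trans_lt (by linarith)⟩
  have hA : IsCompact (Metric.closedBall a r \ Metric.ball a (r / 2)) :=
    (isCompact_closedBall a r).diff Metric.isOpen_ball
  have hfreq : ∃ᶠ k in atTop, x k ∈ Metric.closedBall a r \ Metric.ball a (r / 2) := by
    rw [frequently_atTop]
    intro N
    obtain ⟨N', hN'⟩ := eventually_atTop.1 (hx.eventually_lt_const (half_pos hr))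
    obtain ⟨k₁, hk₁, hk₁a⟩ := frequently_atTop.1
      (mapClusterPt_iff_frequently.1 hacc _ (Metric.ball_mem_nhds a (half_pos hr))) (max N N')
    obtain ⟨k₂, hk₂, hk₂a⟩ := frequently_atTop.1 hfar k₁
    -- At the first exit from the inner ball the step is shorter than `r / 2`, so the sequence
    -- cannot jump over the annulus.
    have hex : ∃ m, r / 2 ≤ dist (x (k₁ + m)) a :=
      ⟨k₂ - k₁, by rw [Nat.add_sub_cancel' hk₂]; linarith⟩
    classical
    have hspec := Nat.find_spec hex
    have hmin := fun m => Nat.find_min (H := hex) (m := m)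
    generalize Nat.find hex = m at hspec hmin
    rcases m with _ | m
    · exact absurd hspec (not_le.2 hk₁a)
    · have h1 := not_le.1 (hmin m (Nat.lt_succ_self m))
      have h2 := hN' (k₁ + m) (by omega)
      rw [← dist_eq_norm] at h2
      have h3 := dist_triangle (x (k₁ + m + 1)) (x (k₁ + m)) a
      refine ⟨k₁ + (m + 1), by omega, ?_, by simpa using hspec⟩
      rw [Metric.mem_closedBall]
      change dist (x (k₁ + m + 1)) a ≤ r
      linarith
  obtain ⟨b, hb, hbacc⟩ := hA.exists_mapClusterPt_of_frequently hfreq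
  have := hiso b hbacc (Metric.closedBall_subset_ball hrδ hb.1)
  exact hb.2 (this ▸ Metric.mem_ball_self (half_pos hr))

/-- A sequence that is eventually antitone and bounded below converges. -/
lemma exists_tendsto_of_antitone_from {V : ℕ → ℝ} {K : ℕ} {B : ℝ}
    (hV : ∀ k ≥ K, V (k + 1) ≤ V k) (hB : ∀ k ≥ K, B ≤ V k) :
    ∃ v, Tendsto V atTop (𝓝 v) := by
  have hanti : Antitone fun k => V (k + K) :=
    antitone_nat_of_succ_le fun k => by
      have := hV (k + K) (by omega)
      rwa [show k + K + 1 = k + 1 + K by omega] at this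
  have hbdd : BddBelow (range fun k => V (k + K)) :=
    ⟨B, by rintro _ ⟨k, rfl⟩; exact hB _ (by omega)⟩
  exact ⟨_, (tendsto_add_atTop_iff_nat K).1 (tendsto_atTop_ciInf hanti hbdd)⟩

/-- The potential `u (k + 1) + a * D k` is bounded below and loses at least `a * (1 - β ^ 2) * D k`
per step; it converges, so the losses vanish. Here `D` plays the role of the squared step length. -/
lemma tendsto_zero_of_extrapolated_decrease {u D : ℕ → ℝ} {K : ℕ} {a β B : ℝ} (ha : 0 < a)
    (hβ0 : 0 ≤ β) (hβ : β < 1) (hD : ∀ k, 0 ≤ D k) (hB : ∀ k ≥ K, B ≤ u (k + 1))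
    (h : ∀ k ≥ K, u (k + 2) + a * D (k + 1) ≤ u (k + 1) + a * β ^ 2 * D k) :
    Tendsto D atTop (𝓝 0) := by
  have hβ2 : 0 < 1 - β ^ 2 := by nlinarith
  have hstep : ∀ k ≥ K, u (k + 2) + a * D (k + 1) ≤ u (k + 1) + a * D k
      - a * (1 - β ^ 2) * D k := fun k hk => by have := h k hk; linarith
  have hpos : ∀ k, 0 ≤ a * (1 - β ^ 2) * D k := fun k => by have := hD k; positivity
  obtain ⟨v, hv⟩ := exists_tendsto_of_antitone_from (V := fun k => u (k + 1) + a * D k)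
    (K := K) (B := B) (fun k hk => by have := hstep k hk; have := hpos k; linarith)
    (fun k hk => by have := hB k hk; have := mul_nonneg ha.le (hD k); linarith)
  have hdiff := (hv.sub ((tendsto_add_atTop_iff_nat 1).2 hv)).div_const (a * (1 - β ^ 2))
  rw [sub_self, zero_div] at hdiff
  refine tendsto_of_tendsto_of_tendsto_of_le_of_le' tendsto_const_nhds hdiff
    (Eventually.of_forall hD) ?_
  filter_upwards [eventually_ge_atTop K] with k hk
  rw [le_div_iff₀ (by positivity)]
  have := hstep k hk
  linarith

/-- The maximum of `u` over the last `N + 1` indices (fewer if there are not as many). -/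
def windowMax (u : ℕ → ℝ) (N k : ℕ) : ℝ :=
  (Finset.Icc (k - N) k).sup' (Finset.nonempty_Icc.2 (Nat.sub_le k N)) u

lemma le_windowMax (u : ℕ → ℝ) (N k : ℕ) : u k ≤ windowMax u N k :=
  Finset.le_sup' u (Finset.mem_Icc.2 ⟨Nat.sub_le k N, le_rfl⟩)

lemma windowMax_succ_le {u : ℕ → ℝ} {N k : ℕ} (h : u (k + 1) ≤ windowMax u N k) :
    windowMax u N (k + 1) ≤ windowMax u N k := by
  refine Finset.sup'_le _ _ fun j hj => ?_
  rw [Finset.mem_Icc] at hj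
  rcases Nat.lt_or_ge k j with h1 | h1
  · rwa [show j = k + 1 by omega]
  · exact Finset.le_sup' u (Finset.mem_Icc.2 ⟨by omega, h1⟩)

lemma exists_windowMax_eq (u : ℕ → ℝ) (N k : ℕ) :
    ∃ j, k - N ≤ j ∧ j ≤ k ∧ windowMax u N k = u j := by
  obtain ⟨j, hj, he⟩ := Finset.exists_mem_eq_sup' (Finset.nonempty_Icc.2 (Nat.sub_le k N)) u
  exact ⟨j, (Finset.mem_Icc.1 hj).1, (Finset.mem_Icc.1 hj).2, he⟩

/-- In a nonmonotone line search for a function that is uniformly continuous along the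
iterates, the distance of successive iterates tends to zero. -/
lemma tendsto_zero_of_nonmonotone_decrease {φ : E n → ℝ} {S : Set (E n)} {x : ℕ → E n}
    {K N : ℕ} {c B : ℝ} (hc : 0 < c) (hφ : UniformContinuousOn φ S) (hxS : ∀ k ≥ K, x k ∈ S)
    (hB : ∀ k ≥ K, B ≤ φ (x k))
    (h : ∀ k ≥ K, φ (x (k + 1)) ≤ windowMax (fun j => φ (x j)) N k
      - c / 2 * ‖x (k + 1) - x k‖ ^ 2) :
    Tendsto (fun k => ‖x (k + 1) - x k‖) atTop (𝓝 0) := by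
  set u : ℕ → ℝ := fun j => φ (x j) with hu
  obtain ⟨v, hv⟩ := exists_tendsto_of_antitone_from (V := windowMax u N) (K := K) (B := B)
    (fun k hk => windowMax_succ_le (by
      have := h k hk
      have : 0 ≤ c / 2 * ‖x (k + 1) - x k‖ ^ 2 := by positivity
      simp only [hu] at *
      linarith))
    (fun k hk => (hB k hk).trans (le_windowMax u N k))
  -- Where the value after a step approaches the limit `v` of the window maxima, the decrease
  -- inequality squeezes the step to zero; uniform continuity (`hprev`) then carries the limit `v`
  -- one index back.
  have hdist : ∀ q : ℕ → ℕ, Tendsto q atTop atTop →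
      Tendsto (fun k => u (q k + 1)) atTop (𝓝 v) →
      Tendsto (fun k => ‖x (q k + 1) - x (q k)‖) atTop (𝓝 0) := by
    intro q hq hqv
    have h1 := ((hv.comp hq).sub hqv).div_const (c / 2)
    rw [sub_self, zero_div] at h1
    have h2 : Tendsto (fun k => ‖x (q k + 1) - x (q k)‖ ^ 2) atTop (𝓝 0) := by
      refine tendsto_of_tendsto_of_tendsto_of_le_of_le' tendsto_const_nhds h1
        (Eventually.of_forall fun k => by positivity) ?_
      filter_upwards [hq.eventually_ge_atTop K] with k hk
      rw [le_div_iff₀ (by positivity)]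
      have := h (q k) hk
      simp only [Function.comp, hu] at *
      linarith
    have h3 := h2.sqrt
    simpa [Real.sqrt_sq] using h3
  have hprev : ∀ q : ℕ → ℕ, Tendsto q atTop atTop →
      Tendsto (fun k => u (q k + 1)) atTop (𝓝 v) → Tendsto (fun k => u (q k)) atTop (𝓝 v) := by
    intro q hq hqv
    have h1 := hdist q hq hqv
    have h2 : Tendsto (fun k => dist (u (q k)) (u (q k + 1))) atTop (𝓝 0) := by
      rw [Metric.tendsto_nhds]
      intro ε hε
      obtain ⟨δ, hδ, hδε⟩ := Metric.uniformContinuousOn_iff.1 hφ ε hε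
      filter_upwards [h1.eventually_lt_const hδ, hq.eventually_ge_atTop K] with k hk hk'
      have := hδε (x (q k)) (hxS _ hk') (x (q k + 1)) (hxS _ (by omega))
        (by rw [dist_comm, dist_eq_norm]; exact hk)
      simpa using this
    rw [tendsto_iff_dist_tendsto_zero] at hqv ⊢
    have h3 := h2.add hqv
    rw [add_zero] at h3
    exact squeeze_zero (fun _ => dist_nonneg) (fun k => dist_triangle _ _ _) h3
  choose ℓ hℓ₁ hℓ₂ hℓ using exists_windowMax_eq u N
  have hqi : ∀ i, Tendsto (fun k => ℓ (k + N + 1) - i) atTop atTop := by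
    intro i
    refine tendsto_atTop_mono (f := fun k => k - i) (fun k => ?_) (tendsto_sub_atTop_nat i)
    have := hℓ₁ (k + N + 1)
    omega
  -- Backward induction from the maximizing indices. Since `ℓ (k + N + 1)` lies in `[k + 1, k + N +
  -- 1]`, at most `N + 1` steps back reach `k`, so finitely many `i` cover the whole sequence.
  have hback : ∀ i, Tendsto (fun k => u (ℓ (k + N + 1) - i)) atTop (𝓝 v) := by
    intro i
    induction i with
    | zero =>
      simp only [Nat.sub_zero, ← hℓ]
      exact hv.comp (tendsto_add_atTop_nat (N + 1))
    | succ i ih =>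
      refine hprev _ (hqi (i + 1)) (ih.congr' ?_)
      filter_upwards [eventually_ge_atTop (i + 1)] with k hk
      have := hℓ₁ (k + N + 1)
      congr 1
      omega
  have huv : Tendsto u atTop (𝓝 v) := by
    rw [Metric.tendsto_nhds]
    intro ε hε
    have hall : ∀ᶠ k in atTop, ∀ i ∈ Finset.range (N + 2),
        dist (u (ℓ (k + N + 1) - i)) v < ε :=
      (Finset.eventually_all _).2 fun i _ => Metric.tendsto_nhds.1 (hback i) ε hε
    filter_upwards [hall] with k hk
    have h1 := hℓ₁ (k + N + 1)
    have h2 := hℓ₂ (k + N + 1)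
    have := hk (ℓ (k + N + 1) - k) (Finset.mem_range.2 (by omega))
    rwa [show ℓ (k + N + 1) - (ℓ (k + N + 1) - k) = k by omega] at this
  exact hdist id tendsto_id ((tendsto_add_atTop_iff_nat 1).2 huv)

end Sequences

end SparseGroup

/-! ### Sufficient decrease for the two algorithms. -/

namespace SparseGroup

namespace Problem

variable {n L : ℕ} {P : Problem n L}

/-- The model with its quadratic correction majorizes the relaxed objective. -/
lemma F_le_model (hP : P.Assumptions) {I : Fin n → Fin 3} {J : Fin L → Fin 2} {ξ y z : E n}
    {μ : ℝ} (hξ : ξ ∈ subdiff (fun v => P.Theta I J v μ) z) (v : E n) :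
    P.F v μ ≤ P.model I J ξ μ y z v + P.Ls / 2 * ‖v - y‖ ^ 2 := by
  have h1 := F_le hP I J v μ
  have h2 := le_quadratic_of_gradient_lipschitz hP.fs_differentiable hP.fs_gradient_lipschitz y v
  have h3 := hξ v
  have h4 := hP.f_split v
  unfold model
  simp only at h3
  linarith

/-- At the current iterate the model minorizes the relaxed objective. -/
lemma model_self_le (hP : P.Assumptions) {I : Fin n → Fin 3} {J : Fin L → Fin 2} (ξ y : E n)
    {x : E n} {μ : ℝ} (hI : IsIdxI μ x I) (hJ : P.IsIdxJ μ x J) :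
    P.model I J ξ μ y x x ≤ P.F x μ := by
  have h1 := inner_gradient_le hP.fs_convex hP.fs_differentiable y x
  have h2 := hP.f_split x
  rw [F_eq_of_isIdx hI hJ]
  unfold model
  rw [sub_self, inner_zero_right]
  linarith

lemma convexOn_model (hP : P.Assumptions) (I : Fin n → Fin 3) (J : Fin L → Fin 2) (ξ y z : E n)
    {μ : ℝ} (hμ : 0 < μ) : ConvexOn ℝ univ (P.model I J ξ μ y z) := by
  have h1 := hP.fn_convex.add (convexOn_penalty hP hμ)
  have h2 : ConvexOn ℝ univ fun v : E n => (innerSL ℝ (gradient P.fs y - ξ)) v :=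
    (innerSL ℝ (gradient P.fs y - ξ)).toLinearMap.convexOn convex_univ
  refine ((h1.add h2).add_const (P.fs y - inner ℝ (gradient P.fs y) y - P.Theta I J z μ
    + inner ℝ ξ z)).congr fun v _ => ?_
  simp only [Pi.add_apply, innerSL_apply_apply, model, inner_sub_left, inner_sub_right]
  ring

/-- What the convergence analysis uses of the iterations: from some index on, `x (k + 1)` is a
proximal step with bounded parameter at the parameter `ν`, taken from a point `y k` close
to `x k`. -/
def IsEventuallyProximal (P : Problem n L) (x : ℕ → E n) : Prop :=
  ∃ (K : ℕ) (A : ℝ) (y : ℕ → E n), Tendsto (fun k => y k - x k) atTop (𝓝 0) ∧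
    ∀ k ≥ K, ∃ (I : Fin n → Fin 3) (J : Fin L → Fin 2) (ξ : E n) (α : ℝ), 0 ≤ α ∧ α ≤ A ∧
      IsIdxI P.nu (x k) I ∧ P.IsIdxJ P.nu (x k) J ∧
      ξ ∈ subdiff (fun v => P.Theta I J v P.nu) (x k) ∧
      IsArgmin (fun v => P.model I J ξ P.nu (y k) (x k) v + α / 2 * ‖v - y k‖ ^ 2) P.Omega
        (x (k + 1))

lemma exists_forall_ge_eq_nu {μ κ : ℕ → ℝ} (hμ : P.IsMuSeq μ) (hκ : P.IsIdxParam μ κ) :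
    ∃ K, ∀ k ≥ K, μ k = P.nu ∧ κ k = P.nu := by
  obtain ⟨K, μbar, -, -, -, h⟩ := hμ
  have h1 : ∀ k ≥ K, μ k = P.nu := fun k hk => by rw [h k, if_neg (not_lt.2 hk)]
  refine ⟨K, fun k hk => ⟨h1 k hk, ?_⟩⟩
  rcases hκ with h2 | h2
  · exact h2 k
  · rw [h2 k, h1 k hk]

lemma IsLineSearchRun.mem_Omega {x : ℕ → E n} (hx : P.IsLineSearchRun x) (k : ℕ) :
    x k ∈ P.Omega := by
  obtain ⟨μ, κ, αB, ρ, c, αlo, αhi, N, -, -, -, -, -, -, -, -, h0, h⟩ := hx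
  cases k with
  | zero => exact h0
  | succ k =>
    obtain ⟨I, J, m, ξ, z, -, -, h1, -, -, h2⟩ := h k
    exact h2 ▸ (h1 m le_rfl).2.1

lemma IsExtrapolationRun.mem_Omega {x : ℕ → E n} (hx : P.IsExtrapolationRun x) (k : ℕ) :
    x k ∈ P.Omega := by
  obtain ⟨μ, κ, βs, β, xinit, y, -, -, -, -, -, h0, -, -, h⟩ := hx
  cases k with
  | zero => exact h0
  | succ k =>
    obtain ⟨I, J, ξ, -, -, -, h2⟩ := h k
    exact h2.1

/-- The line search accepts as soon as the stepsize parameter is at least `L_s + c`. -/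
lemma F_le_sub_of_isArgmin (hP : P.Assumptions) {I : Fin n → Fin 3} {J : Fin L → Fin 2}
    {ξ x z : E n} {μ α c : ℝ} (hI : IsIdxI μ x I) (hJ : P.IsIdxJ μ x J)
    (hξ : ξ ∈ subdiff (fun v => P.Theta I J v μ) x) (hx : x ∈ P.Omega)
    (hz : IsArgmin (fun v => P.model I J ξ μ x x v + α / 2 * ‖v - x‖ ^ 2) P.Omega z)
    (hα : P.Ls + c ≤ α) : P.F z μ ≤ P.F x μ - c / 2 * ‖z - x‖ ^ 2 := by
  have h1 := F_le_model hP (y := x) hξ z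
  have h2 := isMinOn_iff.1 hz.2 x hx
  have h3 := model_self_le hP ξ x hI hJ
  simp only [sub_self, norm_zero] at h2
  have h4 := mul_le_mul_of_nonneg_right hα (sq_nonneg ‖z - x‖)
  nlinarith

lemma bddBelow_F_image (hP : P.Assumptions) {S : Set (E n)} (hS : IsCompact S) :
    ∃ B, ∀ x ∈ S, B ≤ P.F x P.nu := by
  obtain ⟨B, hB⟩ := hS.bddBelow_image (continuous_F hP P.nu).continuousOn
  exact ⟨B, fun x hx => hB (mem_image_of_mem _ hx)⟩

lemma IsLineSearchRun.isEventuallyProximal (hP : P.Assumptions) {x : ℕ → E n}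
    (hx : P.IsLineSearchRun x) : P.IsEventuallyProximal x ∧
      Tendsto (fun k => ‖x (k + 1) - x k‖) atTop (𝓝 0) := by
  have hΩ := hx.mem_Omega
  obtain ⟨μ, κ, αB, ρ, c, αlo, αhi, N, hμ, hκ, hρ, hc, -, hαlo, -, hαB, -, h⟩ := hx
  obtain ⟨K, hK⟩ := exists_forall_ge_eq_nu hμ hκ
  constructor
  -- Either the first trial is accepted, with parameter at most `αhi`, or the trial before the
  -- accepted one was rejected, so its parameter was below `L_s + c` and the accepted one is at most
  -- `ρ` times that.
  · refine ⟨K, max αhi (ρ * (P.Ls + c)), x, by simp, fun k hk => ?_⟩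
    obtain ⟨I, J, m, ξ, z, hI, hJ, hstep, hrej, -, hxz⟩ := h k
    rw [(hK k hk).1] at hstep hrej
    rw [(hK k hk).2] at hI hJ
    have hpos : ∀ t, 0 ≤ αB k * ρ ^ t := fun t =>
      mul_nonneg (hαlo.le.trans (hαB k).1) (by positivity)
    refine ⟨I, J, ξ m, αB k * ρ ^ m, hpos m, ?_, hI, hJ, (hstep m le_rfl).1,
      hxz ▸ (hstep m le_rfl).2⟩
    cases m with
    | zero => simpa using Or.inl (hαB k).2
    | succ m =>
      refine le_max_of_le_right ?_
      have hlt : αB k * ρ ^ m < P.Ls + c := by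
        by_contra! hge
        refine hrej m (Nat.lt_succ_self m) ?_
        have h1 := F_le_sub_of_isArgmin hP hI hJ (hstep m (Nat.le_succ m)).1 (hΩ k)
          (hstep m (Nat.le_succ m)).2 hge
        have h2 := le_windowMax (fun j => P.F (x j) P.nu) N k
        exact h1.trans (sub_le_sub_right h2 _)
      rw [pow_succ]
      nlinarith
  · have hdec : ∀ k ≥ K, P.F (x (k + 1)) P.nu ≤ windowMax (fun j => P.F (x j) P.nu) N k
        - c / 2 * ‖x (k + 1) - x k‖ ^ 2 := fun k hk => by
      obtain ⟨I, J, m, ξ, z, -, -, -, -, hacc, hxz⟩ := h k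
      rw [(hK k hk).1, ← hxz] at hacc
      exact hacc
    -- Values of `F` need not decrease, but window maxima do not increase; this confines the
    -- iterates to a compact set, where `F` is uniformly continuous.
    have hmax : ∀ k ≥ K, windowMax (fun j => P.F (x j) P.nu) N k
        ≤ windowMax (fun j => P.F (x j) P.nu) N K := fun k hk => by
      induction k, hk using Nat.le_induction with
      | base => exact le_rfl
      | succ k hk ih =>
        refine (windowMax_succ_le ?_).trans ih
        have : 0 ≤ c / 2 * ‖x (k + 1) - x k‖ ^ 2 := by positivity
        exact (hdec k hk).trans (by linarith)
    obtain ⟨S, hS, hSmem⟩ := exists_isCompact_sublevel hP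
      (windowMax (fun j => P.F (x j) P.nu) N K)
    have hxS : ∀ k ≥ K, x k ∈ S := fun k hk => hSmem _ (hΩ k)
      ((le_windowMax (fun j => P.F (x j) P.nu) N k).trans (hmax k hk))
    obtain ⟨B, hB⟩ := bddBelow_F_image hP hS
    exact tendsto_zero_of_nonmonotone_decrease (φ := fun v => P.F v P.nu) hc
      (hS.uniformContinuousOn_of_continuous (continuous_F hP P.nu).continuousOn) hxS
      (fun k hk => hB _ (hxS k hk)) hdec

lemma IsExtrapolationRun.isEventuallyProximal (hP : P.Assumptions) {x : ℕ → E n}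
    (hx : P.IsExtrapolationRun x) : P.IsEventuallyProximal x ∧
      Tendsto (fun k => ‖x (k + 1) - x k‖) atTop (𝓝 0) := by
  have hΩ := hx.mem_Omega
  obtain ⟨μ, κ, βs, β, xinit, y, hμ, hκ, hβ0, hβ1, hβs, -, -, hy, h⟩ := hx
  obtain ⟨K, hK⟩ := exists_forall_ge_eq_nu hμ hκ
  have hLs := hP.Ls_pos
  have hyx : ∀ k, ‖y (k + 1) - x (k + 1)‖ ≤ β * ‖x (k + 1) - x k‖ := fun k => by
    rw [hy, add_sub_cancel_left, norm_smul, Real.norm_of_nonneg (hβs _).1]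
    exact mul_le_mul_of_nonneg_right (hβs _).2 (norm_nonneg _)
  -- The three-point inequality at the current iterate supplies the squared step on the left. The
  -- shift to `k + 1` avoids the initial extrapolation, where `xinit` is arbitrary.
  have hdec : ∀ k ≥ K, P.F (x (k + 2)) P.nu + P.Ls / 2 * ‖x (k + 2) - x (k + 1)‖ ^ 2
      ≤ P.F (x (k + 1)) P.nu + P.Ls / 2 * β ^ 2 * ‖x (k + 1) - x k‖ ^ 2 := fun k hk => by
    obtain ⟨I, J, ξ, hI, hJ, hξ, hmin⟩ := h (k + 1)
    rw [(hK (k + 1) (by omega)).1] at hξ hmin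
    rw [(hK (k + 1) (by omega)).2] at hI hJ
    have h1 := prox_three_point (convexOn_model hP I J ξ _ _ hP.nu_pos) (convex_Omega P) hmin
      (hΩ (k + 1))
    have h2 := F_le_model hP (y := y (k + 1)) hξ (x (k + 2))
    have h3 := model_self_le hP ξ (y (k + 1)) hI hJ
    have h4 : ‖x (k + 1) - y (k + 1)‖ ^ 2 ≤ β ^ 2 * ‖x (k + 1) - x k‖ ^ 2 := by
      rw [norm_sub_rev, ← mul_pow]
      exact pow_le_pow_left₀ (norm_nonneg _) (hyx k) 2
    rw [norm_sub_rev (x (k + 1)) (x (k + 1 + 1))] at h1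
    have h5 := mul_le_mul_of_nonneg_left h4 (half_pos hLs).le
    rw [show k + 1 + 1 = k + 2 from rfl] at h1
    linarith
  have hβ2 : β ^ 2 ≤ 1 := pow_le_one₀ hβ0 hβ1.le
  have hpot : ∀ k ≥ K, P.F (x (k + 1)) P.nu + P.Ls / 2 * ‖x (k + 1) - x k‖ ^ 2
      ≤ P.F (x (K + 1)) P.nu + P.Ls / 2 * ‖x (K + 1) - x K‖ ^ 2 := fun k hk => by
    induction k, hk using Nat.le_induction with
    | base => exact le_rfl
    | succ k hk ih =>
      have h1 := hdec k hk
      have h2 : P.Ls / 2 * β ^ 2 * ‖x (k + 1) - x k‖ ^ 2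
          ≤ P.Ls / 2 * ‖x (k + 1) - x k‖ ^ 2 :=
        mul_le_mul_of_nonneg_right (mul_le_of_le_one_right (half_pos hLs).le hβ2) (sq_nonneg _)
      rw [show k + 1 + 1 = k + 2 from rfl]
      linarith
  obtain ⟨S, hS, hSmem⟩ := exists_isCompact_sublevel hP
    (P.F (x (K + 1)) P.nu + P.Ls / 2 * ‖x (K + 1) - x K‖ ^ 2)
  obtain ⟨B, hB⟩ := bddBelow_F_image hP hS
  have hsq : Tendsto (fun k => ‖x (k + 1) - x k‖ ^ 2) atTop (𝓝 0) :=
    tendsto_zero_of_extrapolated_decrease (u := fun k => P.F (x k) P.nu) (half_pos hLs) hβ0 hβ1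
      (fun k => sq_nonneg _)
      (fun k hk => hB _ (hSmem _ (hΩ _) (le_trans (le_add_of_nonneg_right (by positivity))
        (hpot k hk)))) hdec
  have hd : Tendsto (fun k => ‖x (k + 1) - x k‖) atTop (𝓝 0) := by
    simpa [Real.sqrt_sq] using hsq.sqrt
  refine ⟨⟨K, P.Ls, y, ?_, fun k hk => ?_⟩, hd⟩
  · rw [← tendsto_add_atTop_iff_nat 1]
    exact squeeze_zero_norm hyx (by simpa using hd.const_mul β)
  · obtain ⟨I, J, ξ, hI, hJ, hξ, hmin⟩ := h k
    rw [(hK k hk).1] at hξ hmin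
    rw [(hK k hk).2] at hI hJ
    exact ⟨I, J, ξ, P.Ls, hLs.le, le_rfl, hI, hJ, hξ, hmin⟩

end Problem

end SparseGroup

/-! ### Limits of subgradients and stationarity of the limit point. -/

namespace SparseGroup

section Subgradients

variable {n : ℕ}

/-- The subgradients of a continuous function are locally bounded. -/
lemma exists_bound_subdiff {h : E n → ℝ} (hh : Continuous h) (a : E n) :
    ∃ M, ∀ z ∈ Metric.closedBall a 1, ∀ ξ ∈ subdiff h z, ‖ξ‖ ≤ M := by
  obtain ⟨M, hM⟩ := (isCompact_closedBall a 2).exists_bound_of_continuousOn hh.continuousOn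
  refine ⟨M + M, fun z hz ξ hξ => ?_⟩
  rw [Metric.mem_closedBall] at hz
  have hMz := abs_le.1 (hM z (by rw [Metric.mem_closedBall]; linarith))
  rcases eq_or_ne ξ 0 with rfl | hne
  · rw [norm_zero]; linarith
  -- The subgradient inequality, tested one unit along `ξ`, bounds `‖ξ‖` by a difference of two
  -- values of `h`.
  have hu : ‖‖ξ‖⁻¹ • ξ‖ = 1 := norm_smul_inv_norm (𝕜 := ℝ) hne
  have hzu : dist (z + ‖ξ‖⁻¹ • ξ) a ≤ 2 := by
    have := dist_triangle (z + ‖ξ‖⁻¹ • ξ) z a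
    rw [dist_eq_norm (z + ‖ξ‖⁻¹ • ξ) z, add_sub_cancel_left, hu] at this
    linarith
  have h1 := hξ (z + ‖ξ‖⁻¹ • ξ)
  have h2 := abs_le.1 (hM _ (Metric.mem_closedBall.2 hzu))
  rw [add_sub_cancel_left, inner_smul_right, real_inner_self_eq_norm_sq, pow_two,
    inv_mul_cancel_left₀ (norm_ne_zero_iff.2 hne)] at h1
  linarith [h1, h2.2, hMz.1]

lemma mem_subdiff_of_tendsto {h : E n → ℝ} (hh : Continuous h) {z ξ : ℕ → E n} {a η : E n}
    (hz : Tendsto z atTop (𝓝 a)) (hξ : Tendsto ξ atTop (𝓝 η))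
    (hmem : ∀ k, ξ k ∈ subdiff h (z k)) : η ∈ subdiff h a := fun v =>
  le_of_tendsto' (((hh.tendsto a).comp hz).add (hξ.inner (tendsto_const_nhds.sub hz)))
    fun k => hmem k v

/-- If a function is differentiable along a line, its subgradients give the derivative. -/
lemma hasDerivAt_line_of_mem_subdiff {h : E n → ℝ} {a d ξ : E n} (hξ : ξ ∈ subdiff h a)
    (hd : DifferentiableAt ℝ (fun t : ℝ => h (a + t • d)) 0) :
    HasDerivAt (fun t : ℝ => h (a + t • d)) (inner ℝ ξ d) 0 := by
  have h1 : HasDerivAt (fun t : ℝ => h (a + t • d) - t * inner ℝ ξ d)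
      (deriv (fun t : ℝ => h (a + t • d)) 0 - 1 * inner ℝ ξ d) 0 :=
    hd.hasDerivAt.sub ((hasDerivAt_id (0:ℝ)).mul_const _)
  -- The subgradient inequality says that this function is minimal at zero, so its derivative
  -- vanishes.
  have h2 : IsLocalMin (fun t : ℝ => h (a + t • d) - t * inner ℝ ξ d) 0 :=
    Eventually.of_forall fun t => by
      have := hξ (a + t • d)
      rw [add_sub_cancel_left, inner_smul_right] at this
      simp only [zero_smul, add_zero, zero_mul, sub_zero]
      linarith
  have h3 := h2.hasDerivAt_eq_zero h1
  exact hd.hasDerivAt.congr_deriv (by linarith)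

end Subgradients

namespace Problem

variable {n L : ℕ} {P : Problem n L}

lemma continuous_model (hP : P.Assumptions) (I : Fin n → Fin 3) (J : Fin L → Fin 2) (μ : ℝ) :
    Continuous fun q : E n × E n × E n × E n =>
      P.model I J q.1 μ q.2.1 q.2.2.1 q.2.2.2 := by
  have h1 := continuous_of_convexOn hP.fn_convex
  have h2 := hP.fs_differentiable.continuous
  have h3 := P.continuous_penalty μ
  have h4 := P.continuous_Theta I J μ
  have h5 : Continuous (gradient P.fs) :=
    (LipschitzWith.of_dist_le_mul (K := ⟨P.Ls, hP.Ls_pos.le⟩) fun x y => by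
      rw [dist_eq_norm, dist_eq_norm]; exact hP.fs_gradient_lipschitz x y).continuous
  unfold model
  fun_prop

/-- The optimality condition that limits of the iterates satisfy: `a` minimizes over the box,
up to a quadratic term, the model built at `a` with fixed index vectors that are compatible
with `a`. -/
structure IsLiftedStationary (P : Problem n L) (a : E n) (I : Fin n → Fin 3) (J : Fin L → Fin 2)
    (ξ : E n) (A : ℝ) : Prop where
  mem : a ∈ P.Omega
  ge_of_one : ∀ j, I j = 1 → P.nu ≤ a j
  le_of_two : ∀ j, I j = 2 → a j ≤ -P.nu
  idx_group : ∀ l, J l = 0 → ∀ j ∈ P.G l, I j = 0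
  subgrad : ξ ∈ subdiff (fun v => P.Theta I J v P.nu) a
  model_le : ∀ v ∈ P.Omega, P.model I J ξ P.nu a a a
    ≤ P.model I J ξ P.nu a a v + A / 2 * ‖v - a‖ ^ 2

/-- By pigeonhole one index pair occurs infinitely often, and local boundedness of subgradients
gives a further subsequence along which `ξ` converges. The stepsize parameters need not converge:
the proximal term on the left is dropped and the one on the right is enlarged to `A`. -/
lemma IsEventuallyProximal.exists_isLiftedStationary (hP : P.Assumptions) {x : ℕ → E n}
    (hx : P.IsEventuallyProximal x) (hΩ : ∀ k, x k ∈ P.Omega) {a : E n}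
    (ha : Tendsto x atTop (𝓝 a)) : ∃ I J ξ A, P.IsLiftedStationary a I J ξ A := by
  obtain ⟨K, A, y, hyx, hstep⟩ := hx
  have hy : Tendsto y atTop (𝓝 a) := by simpa using hyx.add ha
  choose! I J ξ α hα0 hαA hI hJ hξ hmin using hstep
  obtain ⟨⟨I₀, J₀⟩, hfreq⟩ : ∃ c, ∃ᶠ k in atTop, (I k, J k) = c := by
    by_contra! hcon
    obtain ⟨k, hk⟩ := (eventually_all.2 hcon).exists
    exact hk _ rfl
  obtain ⟨M, hM⟩ := exists_bound_subdiff (P.continuous_Theta I₀ J₀ P.nu) a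
  obtain ⟨φ, hφ, hφP⟩ := extraction_of_frequently_atTop (hfreq.and_eventually
    ((ha.eventually (Metric.closedBall_mem_nhds a one_pos)).and (eventually_ge_atTop K)))
  have hIφ : ∀ k, I (φ k) = I₀ := fun k => congrArg Prod.fst (hφP k).1
  have hJφ : ∀ k, J (φ k) = J₀ := fun k => congrArg Prod.snd (hφP k).1
  have hKφ : ∀ k, φ k ≥ K := fun k => (hφP k).2.2
  have hξφ : ∀ k, ξ (φ k) ∈ subdiff (fun v => P.Theta I₀ J₀ v P.nu) (x (φ k)) := fun k => by
    have := hξ _ (hKφ k)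
    rwa [hIφ, hJφ] at this
  obtain ⟨η, -, ψ, hψ, hη⟩ := tendsto_subseq_of_bounded
    (Metric.isBounded_closedBall (x := (0 : E n)) (r := M)) (x := ξ ∘ φ) fun k => by
      rw [mem_closedBall_zero_iff]
      exact hM _ (hφP k).2.1 _ (hξφ k)
  have hφψ : Tendsto (fun k => φ (ψ k)) atTop atTop :=
    hφ.tendsto_atTop.comp hψ.tendsto_atTop
  have hxφ : Tendsto (fun k => x (φ (ψ k))) atTop (𝓝 a) := ha.comp hφψ
  have hxφ' : Tendsto (fun k => x (φ (ψ k) + 1)) atTop (𝓝 a) :=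
    ((tendsto_add_atTop_iff_nat 1).2 ha).comp hφψ
  have hyφ : Tendsto (fun k => y (φ (ψ k))) atTop (𝓝 a) := hy.comp hφψ
  have hcoord : ∀ j, Tendsto (fun k => x (φ (ψ k)) j) atTop (𝓝 (a j)) := fun j =>
    ((EuclideanSpace.proj j : E n →L[ℝ] ℝ).continuous.tendsto a).comp hxφ
  have hIdx : ∀ k, IsIdxI P.nu (x (φ k)) I₀ := fun k => hIφ k ▸ hI _ (hKφ k)
  have hJdx : ∀ k, P.IsIdxJ P.nu (x (φ k)) J₀ := fun k => hJφ k ▸ hJ _ (hKφ k)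
  refine ⟨I₀, J₀, η, A, ⟨?_, ?_, ?_, ?_, ?_, ?_⟩⟩
  · exact (isClosed_Omega P).mem_of_tendsto ha (Eventually.of_forall hΩ)
  · exact fun j hj => ge_of_tendsto' (hcoord j) fun k => le_of_isIdxI_one hP.nu_pos (hIdx _) hj
  · exact fun j hj => le_of_tendsto' (hcoord j) fun k => le_of_isIdxI_two hP.nu_pos (hIdx _) hj
  · intro l hl j hj
    -- This is derived at an iterate rather than at `a`, because the strict bound on the group norm
    -- would not survive the limit.
    by_contra hne
    have h1 := le_abs_of_isIdxI hP.nu_pos (hIdx 0) hne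
    have h2 := groupNorm_lt_of_isIdxJ hP.nu_pos (hJdx 0) hl
    have h3 := abs_le_groupNorm hP hj (x (φ 0))
    linarith
  · exact mem_subdiff_of_tendsto (P.continuous_Theta I₀ J₀ P.nu) hxφ hη fun k => hξφ (ψ k)
  · intro v hv
    have hc := continuous_model hP I₀ J₀ P.nu
    have hl := (hc.tendsto (η, a, a, a)).comp
      (hη.prodMk_nhds (hyφ.prodMk_nhds (hxφ.prodMk_nhds hxφ')))
    have hr := (hc.tendsto (η, a, a, v)).comp
      (hη.prodMk_nhds (hyφ.prodMk_nhds (hxφ.prodMk_nhds tendsto_const_nhds)))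
    have hq : Tendsto (fun k => A / 2 * ‖v - y (φ (ψ k))‖ ^ 2) atTop
        (𝓝 (A / 2 * ‖v - a‖ ^ 2)) :=
      (((tendsto_const_nhds.sub hyφ).norm).pow 2).const_mul _
    refine le_of_tendsto_of_tendsto' hl (hr.add hq) fun k => ?_
    have h1 := isMinOn_iff.1 (hmin _ (hKφ (ψ k))).2 v hv
    rw [hIφ, hJφ] at h1
    have h2 : 0 ≤ α (φ (ψ k)) / 2 * ‖x (φ (ψ k) + 1) - y (φ (ψ k))‖ ^ 2 :=
      mul_nonneg (by have := hα0 _ (hKφ (ψ k)); positivity) (sq_nonneg _)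
    have h3 : α (φ (ψ k)) / 2 * ‖v - y (φ (ψ k))‖ ^ 2 ≤ A / 2 * ‖v - y (φ (ψ k))‖ ^ 2 := by
      gcongr
      exact hαA _ (hKφ (ψ k))
    simp only [Function.comp]
    linarith

lemma differentiableAt_Theta_line (hP : P.Assumptions) (I : Fin n → Fin 3) (J : Fin L → Fin 2)
    (μ : ℝ) {a d : E n} (h : ∀ j, a j = 0 → d j = 0) :
    DifferentiableAt ℝ (fun t : ℝ => P.Theta I J (a + t • d) μ) 0 := by
  unfold Theta
  refine ((DifferentiableAt.fun_sum fun j _ => ?_).const_mul _).add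
    ((DifferentiableAt.fun_sum fun l _ => ?_).const_mul _)
  · exact (differentiable_theta (I j) μ _).fun_comp' (0:ℝ)
      (show DifferentiableAt ℝ (fun t : ℝ => a j + t * d j) 0 by fun_prop)
  · exact ((differentiable_theta (J l).castSucc μ _).fun_comp' (0:ℝ)
      (differentiableAt_groupNorm_line hP l h)).const_mul _

namespace IsLiftedStationary

variable {a : E n} {I : Fin n → Fin 3} {J : Fin L → Fin 2} {ξ : E n} {A : ℝ}

/-- The optimality condition tested in directions supported in the support of `a`. -/
lemma le_add_of_direction (hP : P.Assumptions) (h : P.IsLiftedStationary a I J ξ A) {d : E n}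
    (hd : ∀ j, a j = 0 → d j = 0) (had : a + d ∈ P.Omega) {D : ℝ}
    (hD : ∀ᶠ t : ℝ in 𝓝[>] 0, P.penalty (a + t • d) P.nu - P.Theta I J (a + t • d) P.nu
      ≤ P.penalty a P.nu - P.Theta I J a P.nu + t * D) :
    P.f a ≤ P.f (a + d) + D := by
  have hslope := (hasDerivAt_line_of_mem_subdiff h.subgrad
    (differentiableAt_Theta_line hP I J P.nu hd)).tendsto_slope_zero_right
  have hlin : Tendsto (fun t : ℝ => t * (A / 2 * ‖d‖ ^ 2)) (𝓝[>] 0)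
      (𝓝 (0 * (A / 2 * ‖d‖ ^ 2))) :=
    tendsto_nhdsWithin_of_tendsto_nhds (Continuous.tendsto (by fun_prop) _)
  have hlim := (((tendsto_const_nhds (x := P.f (a + d) - P.f a + D)).add hslope).sub
    (tendsto_const_nhds (x := inner ℝ ξ d))).add hlin
  -- Stationarity at `a + t • d` divided by `t`: convexity replaces the linearized `fs` by `fs` and
  -- bounds `f` along the segment by its chord. In the limit the difference quotient of `Theta`
  -- cancels `⟨ξ, d⟩`.
  have hnn : ∀ᶠ t : ℝ in 𝓝[>] 0, 0 ≤ P.f (a + d) - P.f a + D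
      + t⁻¹ • (P.Theta I J (a + (0 + t) • d) P.nu - P.Theta I J (a + (0:ℝ) • d) P.nu)
      - inner ℝ ξ d + t * (A / 2 * ‖d‖ ^ 2) := by
    filter_upwards [hD, Ioo_mem_nhdsGT (one_pos : (0:ℝ) < 1)] with t htD ht
    have hmem : a + t • d ∈ P.Omega := by
      have := (convex_Omega P).add_smul_sub_mem h.mem had ⟨ht.1.le, ht.2.le⟩
      rwa [add_sub_cancel_left] at this
    have h1 := h.model_le _ hmem
    have h2 := inner_gradient_le hP.fs_convex hP.fs_differentiable a (a + t • d)
    have h3 := segment_le hP.f_convex a d ht.1.le ht.2.le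
    have h4 := hP.f_split a
    have h5 := hP.f_split (a + t • d)
    simp only [model, add_sub_cancel_left, sub_self, inner_zero_right, inner_smul_right,
      norm_smul, Real.norm_of_nonneg ht.1.le, mul_pow] at h1 h2
    simp only [zero_add, zero_smul, add_zero, smul_eq_mul]
    refine nonneg_of_mul_nonneg_right (a := t) ?_ ht.1
    have h6 : t * (t⁻¹ * (P.Theta I J (a + t • d) P.nu - P.Theta I J a P.nu))
        = P.Theta I J (a + t • d) P.nu - P.Theta I J a P.nu :=
      mul_inv_cancel_left₀ ht.1.ne' _
    linear_combination h1 + h2 + h3 + htD + h4 - h5 - h6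
  have := ge_of_tendsto hlim hnn
  linarith

/-- Coordinates with the zero piece selected vanish; this is where `ν L_f < λ₁` is used. -/
lemma eq_zero_of_idx (hP : P.Assumptions) (h : P.IsLiftedStationary a I J ξ A) {j : Fin n}
    (hj : I j = 0) : a j = 0 := by
  by_contra hne
  set d : E n := EuclideanSpace.single j (-a j) with hd
  have hdj : d j = -a j := by simp [hd]
  have hdi : ∀ i, i ≠ j → d i = 0 := fun i hi => by simp [hd, hi]
  have hΩ : a + d ∈ P.Omega := add_neg_single_mem_Omega hP h.mem j
  have hν := hP.nu_pos
  have hle : ∀ t : ℝ, 0 ≤ t → t ≤ 1 → ∀ i, |(a + t • d) i| ≤ |a i| := by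
    intro t h0 h1 i
    by_cases hi : i = j
    · subst hi
      have : (a + t • d) i = (1 - t) * a i := by
        simp only [PiLp.add_apply, PiLp.smul_apply, hdj, smul_eq_mul]; ring
      rw [this, abs_mul, abs_of_nonneg (sub_nonneg.2 h1)]
      exact mul_le_of_le_one_left (abs_nonneg _) (by linarith)
    · simp [hdi i hi]
  -- Moving coordinate `j` to zero removes `ℓ₁` penalty at the full rate `λ₁/ν`, since the zero
  -- piece subtracts nothing; the group terms cannot increase.
  have key := h.le_add_of_direction hP (d := d)
    (fun i hi => if hij : i = j then absurd (hij ▸ hi) hne else hdi i hij) hΩ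
    (D := -(P.lam1 * (|a j| / P.nu))) (by
      filter_upwards [Ioo_mem_nhdsGT (one_pos : (0:ℝ) < 1)] with t ht
      rw [penalty_sub_Theta, penalty_sub_Theta]
      have e1 : ∑ i, (|(a + t • d) i| / P.nu - theta (I i) ((a + t • d) i) P.nu)
          = ∑ i, (|a i| / P.nu - theta (I i) (a i) P.nu) - t * (|a j| / P.nu) := by
        rw [eq_sub_iff_add_eq, ← eq_sub_iff_add_eq', ← Finset.sum_sub_distrib,
          Finset.sum_eq_single j]
        · have : (a + t • d) j = (1 - t) * a j := by
            simp only [PiLp.add_apply, PiLp.smul_apply, hdj, smul_eq_mul]; ring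
          rw [hj, theta_zero, theta_zero, this, abs_mul, abs_of_nonneg (sub_nonneg.2 ht.2.le)]
          ring
        · intro i _ hi
          simp [hdi i hi]
        · simp
      have e2 : ∑ l, P.w l * (P.groupNorm l (a + t • d) / P.nu
            - theta (J l).castSucc (P.groupNorm l (a + t • d)) P.nu)
          ≤ ∑ l, P.w l * (P.groupNorm l a / P.nu
            - theta (J l).castSucc (P.groupNorm l a) P.nu) := by
        refine Finset.sum_le_sum fun l _ => mul_le_mul_of_nonneg_left ?_ (hP.w_nonneg l)
        have : J l = 0 ∨ J l = 1 := by omega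
        rcases this with h0 | h1
        · rw [h0]
          change _ - 0 ≤ _ - 0
          have := P.groupNorm_mono (l := l) fun i _ => hle t ht.1.le ht.2.le i
          gcongr
        · rw [h1]
          change _ - (_ - 1) ≤ _ - (_ - 1)
          simp
      have e3 := mul_le_mul_of_nonneg_left e2 hP.lam2_nonneg
      rw [e1]
      linarith)
  -- A subgradient at the endpoint, which lies in the box, bounds the rise of `f` by `L_f |a j|`.
  obtain ⟨ζ, hζ⟩ := subdiff_nonempty hP.f_convex (a + d)
  have h1 := hζ a
  have h2 : inner ℝ ζ (a - (a + d)) = ζ j * a j := by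
    rw [sub_add_cancel_left, inner_neg_right, hd, EuclideanSpace.inner_single_right]
    simp [mul_comm]
  rw [h2] at h1
  have h3 := hP.Lf_bound _ hΩ ζ hζ j
  have h4 : -(ζ j * a j) ≤ P.Lf * |a j| := by
    refine (neg_le_abs _).trans ?_
    rw [abs_mul]
    exact mul_le_mul_of_nonneg_right h3 (abs_nonneg _)
  have h5 : P.Lf < P.lam1 / P.nu := by
    rw [lt_div_iff₀ hν, mul_comm]; exact hP.nu_lt
  have h6 := mul_lt_mul_of_pos_right h5 (abs_pos.2 hne)
  have h7 : P.lam1 * (|a j| / P.nu) = P.lam1 / P.nu * |a j| := by ring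
  linarith

lemma nu_le_abs (hP : P.Assumptions) (h : P.IsLiftedStationary a I J ξ A) {j : Fin n}
    (hj : a j ≠ 0) : P.nu ≤ |a j| := by
  have : I j = 0 ∨ I j = 1 ∨ I j = 2 := by omega
  rcases this with h0 | h1 | h2
  · exact absurd (h.eq_zero_of_idx hP h0) hj
  · exact (h.ge_of_one j h1).trans (le_abs_self _)
  · have := h.le_of_two j h2
    exact le_trans (by linarith) (neg_le_abs _)

/-- A lifted stationary point minimizes the loss over the points of the box with support in
the support of `a`. -/
lemma f_le_of_support (hP : P.Assumptions) (h : P.IsLiftedStationary a I J ξ A) {x : E n}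
    (hx : x ∈ P.Omega) (hsupp : ∀ j, a j = 0 → x j = 0) : P.f a ≤ P.f x := by
  set d := x - a with hd
  have hν := hP.nu_pos
  have hdj : ∀ j, a j = 0 → d j = 0 := fun j hj => by simp [hd, hj, hsupp j hj]
  -- Zero slope suffices: for small `t` each active coordinate or group contributes the constant `1`
  -- to penalty minus pieces, and each inactive one stays zero.
  have key := h.le_add_of_direction hP hdj (by rwa [hd, add_sub_cancel]) (D := 0) (by
    have hI : ∀ᶠ t : ℝ in 𝓝[>] 0, ∀ j,
        |(a + t • d) j| / P.nu - theta (I j) ((a + t • d) j) P.nu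
          = |a j| / P.nu - theta (I j) (a j) P.nu := by
      refine eventually_all.2 fun j => ?_
      have hlim : Tendsto (fun t : ℝ => (a + t • d) j) (𝓝[>] 0) (𝓝 (a j)) := by
        have : Continuous fun t : ℝ => a j + t * d j := by fun_prop
        exact tendsto_nhdsWithin_of_tendsto_nhds (by simpa using this.tendsto 0)
      have : I j = 0 ∨ I j = 1 ∨ I j = 2 := by omega
      rcases this with h0 | h1 | h2
      · have ha := h.eq_zero_of_idx hP h0
        exact Eventually.of_forall fun t => by simp [ha, hdj j ha]
      · have ha : 0 < a j := hν.trans_le (h.ge_of_one j h1)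
        filter_upwards [hlim.eventually_const_lt ha] with t ht
        rw [h1, theta_one, theta_one, abs_of_pos ha, abs_of_pos ht]
        ring
      · have ha : a j < 0 := by have := h.le_of_two j h2; linarith
        filter_upwards [hlim.eventually_lt_const ha] with t ht
        rw [h2, theta_two, theta_two, abs_of_neg ha, abs_of_neg ht]
        ring
    filter_upwards [hI] with t ht
    rw [penalty_sub_Theta, penalty_sub_Theta, Finset.sum_congr rfl fun j _ => ht j, mul_zero,
      add_zero]
    refine le_of_eq ?_
    congr 2
    refine Finset.sum_congr rfl fun l _ => ?_
    have : J l = 0 ∨ J l = 1 := by omega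
    rcases this with h0 | h1
    · have ha : ∀ j ∈ P.G l, a j = 0 := fun j hj =>
        h.eq_zero_of_idx hP (h.idx_group l h0 j hj)
      rw [(groupNorm_eq_zero hP).2 ha, (groupNorm_eq_zero hP).2 fun j hj => by
        simp [ha j hj, hdj j (ha j hj)]]
    · rw [h1]
      change _ * (_ - (_ - 1)) = _ * (_ - (_ - 1))
      simp)
  rwa [hd, add_sub_cancel, add_zero] at key

end IsLiftedStationary

/-! ### From minimality on the support to local minimality of `F₀`. -/

lemma ind_le_ind {s t : ℝ} (h : s ≠ 0 → t ≠ 0) : ind s ≤ ind t := by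
  unfold ind
  split_ifs with h1 h2 h2 <;> simp_all

/-- A point that minimizes the loss over the points of the box with smaller support is a local
minimizer of the sparse group objective. -/
lemma isLocalMinOn_F0 (hP : P.Assumptions) {a : E n}
    (h : ∀ x ∈ P.Omega, (∀ j, a j = 0 → x j = 0) → P.f a ≤ P.f x) :
    IsLocalMinOn P.F0 P.Omega a := by
  have hf : ∀ᶠ x in 𝓝[P.Omega] a, P.f a - P.lam1 < P.f x :=
    eventually_nhdsWithin_of_eventually_nhds
      (((continuous_of_convexOn hP.f_convex).tendsto a).eventually_const_lt
        (sub_lt_self _ hP.lam1_pos))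
  have hne : ∀ᶠ x in 𝓝[P.Omega] a, ∀ j, a j ≠ 0 → x j ≠ 0 :=
    eventually_nhdsWithin_of_eventually_nhds (eventually_all.2 fun j => by
      by_cases hj : a j = 0
      · simp [hj]
      · have hc : Continuous fun x : E n => x j := by fun_prop
        filter_upwards [hc.tendsto a |>.eventually_ne hj] with x hx _ using hx)
  filter_upwards [hf, hne, self_mem_nhdsWithin] with x hxf hxne hxΩ
  have hgroup : P.lam2 * ∑ l, P.w l * ind (P.groupNorm l a)
      ≤ P.lam2 * ∑ l, P.w l * ind (P.groupNorm l x) := by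
    refine mul_le_mul_of_nonneg_left (Finset.sum_le_sum fun l _ =>
      mul_le_mul_of_nonneg_left (ind_le_ind ?_) (hP.w_nonneg l)) hP.lam2_nonneg
    contrapose
    rw [groupNorm_eq_zero hP, groupNorm_eq_zero hP]
    exact fun hx j hj => by_contra fun hj' => hxne j hj' (hx j hj)
  have hnn : ∀ j ∈ Finset.univ, 0 ≤ ind (x j) - ind (a j) := fun j _ =>
    sub_nonneg.2 (ind_le_ind (hxne j))
  unfold F0
  -- With unchanged support the loss decides; otherwise one new nonzero entry costs `λ₁`, and near
  -- `a` the loss drops by less than that.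
  by_cases hs : ∀ j, a j = 0 → x j = 0
  · have h1 := h x hxΩ hs
    have h2 := mul_nonneg hP.lam1_pos.le (Finset.sum_nonneg hnn)
    rw [Finset.sum_sub_distrib, mul_sub] at h2
    linarith
  · push Not at hs
    obtain ⟨j, hj, hxj⟩ := hs
    have h1 := Finset.single_le_sum hnn (Finset.mem_univ j)
    simp only [ind, hj, hxj, if_true, if_false] at h1
    have h2 := mul_le_mul_of_nonneg_left h1 hP.lam1_pos.le
    rw [Finset.sum_sub_distrib, mul_sub, mul_sub] at h2
    simp only [ind] at hgroup ⊢
    linarith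

end Problem

end SparseGroup

theorem proposition4p3 {n L : ℕ} (P : SparseGroup.Problem n L) (hP : P.Assumptions)
    (x : ℕ → SparseGroup.E n) (hx : P.IsLineSearchRun x ∨ P.IsExtrapolationRun x)
    (hiso : ∃ a, SparseGroup.IsIsolatedAccPt x a) :
    ∃ a, Tendsto x atTop (𝓝 a) ∧ P.IsStrongLocalMin a := by
  obtain ⟨a, ha⟩ := hiso
  have hΩ : ∀ k, x k ∈ P.Omega := hx.elim (fun h => h.mem_Omega) fun h => h.mem_Omega
  obtain ⟨hprox, hdiff⟩ := hx.elim (fun h => h.isEventuallyProximal hP)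
    fun h => h.isEventuallyProximal hP
  have hlim := SparseGroup.tendsto_of_isIsolatedAccPt ha hdiff
  obtain ⟨I, J, ξ, A, hst⟩ := hprox.exists_isLiftedStationary hP hΩ hlim
  exact ⟨a, hlim, hst.mem, SparseGroup.Problem.isLocalMinOn_F0 hP fun v hv hs =>
    hst.f_le_of_support hP hv hs, fun j hj => hst.nu_le_abs hP hj⟩
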